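/- Let $c_1,c_2>0$ be arbitrary wave speeds and let $g>0$, $h>0$, $q=0$. Consider on $(0,1)$ the closed-loop system of two coupled wave equations $$ \begin{cases} u_{tt}(x,t)=c_1^2u_{xx}(x,t),\quad v_{tt}(x,t)=c_2^2v_{xx}(x,t), & x\in(0,1),\ t>0,\\ u_x(0,t)=g\,u_t(0,t),\quad u(1,t)=v(0,t),\\ v_x(0,t)=u_x(1,t),\quad v_x(1,t)=-h\,v_t(1,t)-q\,v(1,t), \end{cases} $$ with initial condition $(u,u_t,v,v_t)|_{t=0}=X^0=(u^0,u_t^0,v^0,v_t^0)$ in $$\mathcal H=\{(u,z,v,w)\in H^1(0,1)\times L^2(0,1)\times H^1(0,1)\times L^2(0,1):\ u(1)=v(0)\},$$ and the seminorm $\|(u,z,v,w)\|_{\mathcal H}^2=c_1^2\|u_x\|_{L^2}^2+\|z\|_{L^2}^2+c_2^2\|v_x\|_{L^2}^2+\|w\|_{L^2}^2$ on $\mathcal H$. Solutions are mild solutions: let $T(u,z,v,w)=(z,c_1^2u_{xx},w,c_2^2v_{xx})$, with domain the set of all $(u,z,v,w)\in H^2\times H^1\times H^2\times H^1$ such that $u(1)=v(0)$,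 $z(1)=w(0)$, $u_x(0)=g z(0)$, $v_x(0)=u_x(1)$, $v_x(1)=-h w(1)-q v(1)$. A solution with initial condition $X^0\in\mathcal H$ is a function $X:[0,\infty)\to\mathcal H$, continuous for the norm of $H^1\times L^2\times H^1\times L^2$, such that $X(0)=X^0$ and, for every $t\ge 0$, $\int_0^tX(s)\,ds\in D(T)$ and $X(t)=X^0+T\int_0^tX(s)\,ds$. Then the following hold. 1. There exist $S_1,S_2,S_3,S_4>0$ such that, with $S=\mathrm{diag}(S_1,S_2,S_3,S_4)$, the symmetric matrix $\tilde\Psi=\tilde H^{\top}S\tilde H-\tilde G^{\top}S\tilde G$ is negative definite, where $$ \tilde H=\begin{bmatrix}0&c_1&1&0\\1-c_1g&0&0&0\\0&0&0&1-c_2h\\0&-c_2&1&0\end{bmatrix},\qquad \tilde G=\begin{bmatrix}1+c_1g&0&0&0\\0&-c_1&1&0\\0&c_2&1&0\\0&0&0&1+c_2h\end{bmatrix}. $$ 2. For every $X^0\in\mathcal H$ the closed-loop system has a unique solution $X=(u,u_t,v,v_t)$ on $[0,\infty)$ with initial condition $X^0$, and this solution is $\mathcal H$-exponentially stable. More precisely,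 there are $\gamma>1$ and $\alpha>0$, depending only on $c_1,c_2,g,h$, such that for all $X^0\in\mathcal H$ and all $t\ge0$ $$\|(u(t),u_t(t),v(t),v_t(t))\|_{\mathcal H}\le\gamma\,\|(u^0,u_t^0,v^0,v_t^0)\|_{\mathcal H}\,e^{-\alpha t}.$$ -/

import Mathlib

open Set Filter Topology MeasureTheory

noncomputable section

namespace CoupledWave

/-! ### Function spaces on `[0,1]`

Functions are total functions `ℝ → ℝ`; only their values on `[0,1]` matter. -/

/-- The space derivative on `[0,1]` (one-sided at the two end points). -/
def dx (f : ℝ → ℝ) : ℝ → ℝ := derivWithin f (Icc (0 : ℝ) 1)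

/-- `f` is square integrable on `[0,1]`. -/
def IsL2 (f : ℝ → ℝ) : Prop := MemLp f 2 (volume.restrict (Icc (0 : ℝ) 1))

/-- `f` is (the continuous representative of) an element of `H¹(0,1)`. -/
def IsH1 (f : ℝ → ℝ) : Prop := AbsolutelyContinuousOnInterval f 0 1 ∧ IsL2 (dx f)

/-- `f` is (the continuous representative of) an element of `H²(0,1)`. -/
def IsH2 (f : ℝ → ℝ) : Prop := IsH1 f ∧ IsH1 (dx f)

/-- `‖f‖² = ∫₀¹ f(x)² dx`. -/
def l2sq (f : ℝ → ℝ) : ℝ := ∫ x in (0 : ℝ)..1, f x ^ 2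

/-- Equality almost everywhere on `[0,1]`. -/
def AEEq (f₁ f₂ : ℝ → ℝ) : Prop := f₁ =ᵐ[volume.restrict (Icc (0 : ℝ) 1)] f₂

/-! ### States and the energy space -/

/-- A state `(u, u_t, v, v_t)`. -/
abbrev State : Type := (ℝ → ℝ) × (ℝ → ℝ) × (ℝ → ℝ) × (ℝ → ℝ)

abbrev State.u (X : State) : ℝ → ℝ := X.1
abbrev State.ut (X : State) : ℝ → ℝ := X.2.1
abbrev State.v (X : State) : ℝ → ℝ := X.2.2.1
abbrev State.vt (X : State) : ℝ → ℝ := X.2.2.2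

/-- Membership in `𝓗 = {(u, u_t, v, v_t) ∈ H¹ × L² × H¹ × L² : u(1) = v(0)}`. -/
structure MemH (X : State) : Prop where
  u_mem : IsH1 X.u
  ut_mem : IsL2 X.ut
  v_mem : IsH1 X.v
  vt_mem : IsL2 X.vt
  trace : X.u 1 = X.v 0

/-- Two states are the same element of `𝓗`: the positions agree on `[0,1]` and the velocities
agree almost everywhere. -/
structure SameState (X Y : State) : Prop where
  u_eq : EqOn X.u Y.u (Icc (0 : ℝ) 1)
  ut_eq : AEEq X.ut Y.ut
  v_eq : EqOn X.v Y.v (Icc (0 : ℝ) 1)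
  vt_eq : AEEq X.vt Y.vt

/-- The seminorm
`‖(u, u_t, v, v_t)‖_𝓗 = (c₁² ‖u_x‖² + ‖u_t‖² + c₂² ‖v_x‖² + ‖v_t‖²)^{1/2}`. -/
def seminormH (c₁ c₂ : ℝ) (X : State) : ℝ :=
  Real.sqrt (c₁ ^ 2 * l2sq (dx X.u) + l2sq X.ut + c₂ ^ 2 * l2sq (dx X.v) + l2sq X.vt)

/-- The full Hilbert norm of `H¹ × L² × H¹ × L²`, which gives the topology of the state space
in which solutions are continuous. -/
def fullNorm (X : State) : ℝ :=
  Real.sqrt ((l2sq X.u + l2sq (dx X.u)) + l2sq X.ut + (l2sq X.v + l2sq (dx X.v)) + l2sq X.vt)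

/-! ### The closed-loop system -/

/-- The graph of the generator `T` of the closed-loop system: `X ∈ D(T)` and `T X = Y`, where
`T (u, u_t, v, v_t) = (u_t, c₁² u_xx, v_t, c₂² v_xx)` and `D(T)` consists of the
`(u, u_t, v, v_t) ∈ H² × H¹ × H² × H¹` that satisfy all the boundary conditions
(`trace_pos` and `trace_vel` are the condition `u(1,t) = v(0,t)` and its time derivative;
together they say that both `X` and `T X` lie in `𝓗`). -/
structure GeneratorGraph (c₁ c₂ g h q : ℝ) (X Y : State) : Prop where
  u_mem : IsH2 X.u
  ut_mem : IsH1 X.ut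
  v_mem : IsH2 X.v
  vt_mem : IsH1 X.vt
  trace_pos : X.u 1 = X.v 0
  trace_vel : X.ut 1 = X.vt 0
  bc_u_zero : dx X.u 0 = g * X.ut 0
  bc_interface : dx X.v 0 = dx X.u 1
  bc_v_one : dx X.v 1 = -h * X.vt 1 - q * X.v 1
  u_eq : EqOn Y.u X.ut (Icc (0 : ℝ) 1)
  ut_eq : AEEq Y.ut (fun x => c₁ ^ 2 * dx (dx X.u) x)
  v_eq : EqOn Y.v X.vt (Icc (0 : ℝ) 1)
  vt_eq : AEEq Y.vt (fun x => c₂ ^ 2 * dx (dx X.v) x)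

/-- `X : [0,∞) → 𝓗` is continuous. -/
def ContinuousInH (X : ℝ → State) : Prop :=
  ∀ t, 0 ≤ t → Tendsto (fun s => fullNorm (X s - X t)) (𝓝[Ici 0] t) (𝓝 0)

/-- `Y` is differentiable on `[0,∞)`, in the norm of the state space, with derivative `X`. -/
def HasTimeDerivInH (Y X : ℝ → State) : Prop :=
  ∀ t, 0 ≤ t →
    Tendsto (fun s => fullNorm ((s - t)⁻¹ • (Y s - Y t) - X t)) (𝓝[Ici 0 \ {t}] t) (𝓝 0)

/-- `X` is the (mild) solution on `[0,∞)` of the closed-loop system `dX/dt = T X`, `X(0) = X⁰`: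
it is continuous with values in `𝓗`, and for all `t ≥ 0` its primitive `Y(t) = ∫₀ᵗ X(s) ds`
lies in `D(T)` and satisfies `X(t) = X(0) + T Y(t)`. -/
structure IsSolution (c₁ c₂ g h q : ℝ) (X₀ : State) (X : ℝ → State) : Prop where
  mem : ∀ t, 0 ≤ t → MemH (X t)
  init : SameState (X 0) X₀
  cont : ContinuousInH X
  eqn : ∃ Y : ℝ → State, SameState (Y 0) 0 ∧ HasTimeDerivInH Y X ∧
    ∀ t, 0 ≤ t → GeneratorGraph c₁ c₂ g h q (Y t) (X t - X 0)

/-! ### The matrices of the linear matrix inequality -/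

/-- `H_{c₁, c₁ g}`. -/
def matH (c₁ c₂ g h q : ℝ) : Matrix (Fin 4) (Fin 5) ℝ :=
  !![0, c₁, 1, 0, 0;
     1 - c₁ * g, 0, 0, 0, 0;
     0, 0, 0, 1 - c₂ * h, -c₂ * q;
     0, -c₂, 1, 0, 0]

/-- `G_{c₁, c₁ g}`. -/
def matG (c₁ c₂ g h q : ℝ) : Matrix (Fin 4) (Fin 5) ℝ :=
  !![1 + c₁ * g, 0, 0, 0, 0;
     0, -c₁, 1, 0, 0;
     0, c₂, 1, 0, 0;
     0, 0, 0, 1 + c₂ * h, c₂ * q]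

/-- `Q_α = diag(0_{3,3}, [0, S₅; S₅, 2 α S₅])`. -/
def matQ (α S₅ : ℝ) : Matrix (Fin 5) (Fin 5) ℝ :=
  !![0, 0, 0, 0, 0;
     0, 0, 0, 0, 0;
     0, 0, 0, 0, 0;
     0, 0, 0, 0, S₅;
     0, 0, 0, S₅, 2 * α * S₅]

/-- `E_α(x) = diag(exp(2 α x / c₁) I₂, exp(2 α x / c₂) I₂)`. -/
def matE (c₁ c₂ α x : ℝ) : Matrix (Fin 4) (Fin 4) ℝ :=
  Matrix.diagonal ![Real.exp (2 * α * x * c₁⁻¹), Real.exp (2 * α * x * c₁⁻¹),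
    Real.exp (2 * α * x * c₂⁻¹), Real.exp (2 * α * x * c₂⁻¹)]

/-- `Ψ_{c₁, c₁ g}(α) = Hᵀ E_α(1) S H - Gᵀ S G + Q_α`, where `S = diag(S₁, S₂, S₃, S₄)`. -/
def matPsi (c₁ c₂ g h q : ℝ) (S : Fin 4 → ℝ) (S₅ α : ℝ) : Matrix (Fin 5) (Fin 5) ℝ :=
  (matH c₁ c₂ g h q).transpose * matE c₁ c₂ α 1 * Matrix.diagonal S * matH c₁ c₂ g h q
    - (matG c₁ c₂ g h q).transpose * Matrix.diagonal S * matG c₁ c₂ g h q + matQ α S₅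

/-- `Ψ̃_{c₁, c₁ g}`: the leading `4 × 4` block of `Ψ_{c₁, c₁ g}(0)`. -/
def matPsiTilde (c₁ c₂ g h q : ℝ) (S : Fin 4 → ℝ) (S₅ : ℝ) : Matrix (Fin 4) (Fin 4) ℝ :=
  (matPsi c₁ c₂ g h q S S₅ 0).submatrix Fin.castSucc Fin.castSucc

end CoupledWave

end

/-!
On each string the solution is a superposition of a left-going and a right-going wave, whose
profiles are the Riemann invariants `r = u_t + c u_x` and `p = u_t - c u_x`. The proof treats the
three claims with this decomposition.

*Matrix inequality.* The energy `∫ u_t² / c₁² + u_x² + v_t² / c₂² + v_x²` has a flux, a multiple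
of `u_t u_x` and `v_t v_x`, that is continuous across the interface, and it is strictly dissipated
at the two outer ends. Lowering by a factor `1 / (1 + κ)` the weights of the two invariants that
leave the interface makes the quadratic form strictly negative there too, and for small `κ > 0`
the ends keep their sign (`exists_slope`, `posDef_neg_matPsiTilde`).

*Decay and uniqueness.* Giving the invariants affine weights of slope `κ` yields a Lyapunov
functional `energy`, equivalent to the square of the seminorm, whose derivative along the
generator is at most `-decayRate` times itself (`energyDeriv_le`): the boundary terms are
controlled as in the matrix inequality, the slope of the weights gives the bulk term. A mild
solution `X` need not lie in the domain of the generator, but the difference quotients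
`(Y (t + δ) - Y t) / δ` of its primitive `Y` do, solve the equation in the strong sense and
converge to `X`;
this carries the decay over to `X` (`IsMildPair.energy_le`). The difference of two solutions with
the same initial value therefore has zero energy, hence vanishing velocity, hence constant (zero)
position (`IsSolution.unique`).

*Existence.* The boundary traces of the Riemann invariants have to solve a linear delay equation
whose delays are the travel times `1 / c₁` and `1 / c₂`, which the method of steps does
(`exists_delay_solution`). D'Alembert's formula then gives `X`. Its continuity in time and the
differentiability of its primitive reduce to two facts on locally square integrable functions of
one variable: continuity of translations and `L²` convergence of the difference quotients of
primitives (`tendsto_l2sq_translate`, `tendsto_l2sq_quotErr`, `exists_isSolution`).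
-/

noncomputable section

namespace CoupledWave

/-! ### Weak derivatives on the unit interval -/

/-- Lebesgue measure on `[0,1]`. -/
abbrev unitMeasure : Measure ℝ := volume.restrict (Icc (0 : ℝ) 1)

/-- `f` is a primitive on `[0,1]` of the square integrable function `d`. This is the form in which
membership in `H¹(0,1)` is used, see `IsH1.hasWeakDeriv` and `HasWeakDeriv.isH1`. -/
structure HasWeakDeriv (f d : ℝ → ℝ) : Prop where
  isL2 : IsL2 d
  eq_integral : ∀ x ∈ Icc (0 : ℝ) 1, f x = f 0 + ∫ y in (0 : ℝ)..x, d y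

lemma IsL2.intervalIntegrable {f : ℝ → ℝ} (hf : IsL2 f) {a b : ℝ} (ha : a ∈ Icc (0 : ℝ) 1)
    (hb : b ∈ Icc (0 : ℝ) 1) : IntervalIntegrable f volume a b := by
  have h1 : IntegrableOn f (Icc (0 : ℝ) 1) := hf.integrable (by norm_num)
  exact (h1.mono_set (uIcc_subset_Icc ha hb)).intervalIntegrable

lemma ae_unitMeasure_iff {p : ℝ → Prop} :
    (∀ᵐ x ∂unitMeasure, p x) ↔ ∀ᵐ x, x ∈ Ioo (0 : ℝ) 1 → p x := by
  rw [unitMeasure, ← restrict_Ioo_eq_restrict_Icc, ae_restrict_iff' measurableSet_Ioo]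

lemma AEEq.intervalIntegral_congr {f g : ℝ → ℝ} (h : AEEq f g) {x : ℝ}
    (hx : x ∈ Icc (0 : ℝ) 1) : ∫ y in (0 : ℝ)..x, f y = ∫ y in (0 : ℝ)..x, g y := by
  refine intervalIntegral.integral_congr_ae ?_
  have h' : ∀ᵐ y, y ∈ Icc (0 : ℝ) 1 → f y = g y := (ae_restrict_iff' measurableSet_Icc).1 h
  filter_upwards [h'] with y hy hy'
  rw [uIoc_of_le hx.1] at hy'
  exact hy ⟨hy'.1.le, hy'.2.trans hx.2⟩

lemma AEEq.of_eqOn {f g : ℝ → ℝ} (h : EqOn f g (Icc (0 : ℝ) 1)) : AEEq f g := by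
  filter_upwards [ae_restrict_mem measurableSet_Icc] with x hx using h hx

lemma dx_eqOn_of_eqOn {f g : ℝ → ℝ} (h : EqOn f g (Icc (0 : ℝ) 1)) :
    EqOn (dx f) (dx g) (Icc (0 : ℝ) 1) := fun _ hx =>
  derivWithin_congr h (h hx)

lemma dx_eq_deriv {f : ℝ → ℝ} {x : ℝ} (hx : x ∈ Ioo (0 : ℝ) 1) : dx f x = deriv f x :=
  derivWithin_of_mem_nhds (Icc_mem_nhds hx.1 hx.2)

lemma absolutelyContinuousOnInterval_congr {f g : ℝ → ℝ}
    (hf : AbsolutelyContinuousOnInterval f 0 1) (h : EqOn f g (Icc (0 : ℝ) 1)) :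
    AbsolutelyContinuousOnInterval g 0 1 := by
  refine Tendsto.congr' ?_ hf
  rw [EventuallyEq, eventually_inf_principal]
  refine Eventually.of_forall fun E hE => Finset.sum_congr rfl fun i hi => ?_
  have := hE.1 i hi
  rw [uIcc_of_le zero_le_one] at this
  rw [h this.1, h this.2]

namespace HasWeakDeriv

variable {f g d e : ℝ → ℝ}

lemma congr (h : HasWeakDeriv f d) (hfg : EqOn f g (Icc (0 : ℝ) 1)) (hde : AEEq d e) :
    HasWeakDeriv g e where
  isL2 := h.isL2.ae_eq hde
  eq_integral x hx := by
    rw [← hfg hx, ← hfg (left_mem_Icc.2 zero_le_one), h.eq_integral x hx,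
      hde.intervalIntegral_congr hx]

lemma add (hf : HasWeakDeriv f d) (hg : HasWeakDeriv g e) : HasWeakDeriv (f + g) (d + e) where
  isL2 := MemLp.add hf.isL2 hg.isL2
  eq_integral x hx := by
    have h0 : (0 : ℝ) ∈ Icc (0 : ℝ) 1 := left_mem_Icc.2 zero_le_one
    simp only [Pi.add_apply]
    rw [hf.eq_integral x hx, hg.eq_integral x hx,
      intervalIntegral.integral_add (hf.isL2.intervalIntegrable h0 hx)
        (hg.isL2.intervalIntegrable h0 hx)]
    ring

lemma smul (a : ℝ) (hf : HasWeakDeriv f d) : HasWeakDeriv (a • f) (a • d) where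
  isL2 := MemLp.const_smul hf.isL2 a
  eq_integral x hx := by
    simp only [Pi.smul_apply, smul_eq_mul]
    rw [hf.eq_integral x hx, intervalIntegral.integral_const_mul]
    ring

lemma sub (hf : HasWeakDeriv f d) (hg : HasWeakDeriv g e) : HasWeakDeriv (f - g) (d - e) := by
  have := hf.add (hg.smul (-1))
  simpa [sub_eq_add_neg] using this

lemma absolutelyContinuous (h : HasWeakDeriv f d) : AbsolutelyContinuousOnInterval f 0 1 := by
  have h0 : (0 : ℝ) ∈ Icc (0 : ℝ) 1 := left_mem_Icc.2 zero_le_one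
  have h1 : (1 : ℝ) ∈ Icc (0 : ℝ) 1 := right_mem_Icc.2 zero_le_one
  have hc : AbsolutelyContinuousOnInterval (fun _ : ℝ => f 0) 0 1 :=
    (LipschitzWith.const (f 0)).lipschitzOnWith.absolutelyContinuousOnInterval
  have hi := (h.isL2.intervalIntegrable h0
    h1).absolutelyContinuousOnInterval_intervalIntegral (c := 0) (by simp)
  exact absolutelyContinuousOnInterval_congr (hc.add hi) fun x hx => (h.eq_integral x hx).symm

lemma continuousOn (h : HasWeakDeriv f d) : ContinuousOn f (Icc (0 : ℝ) 1) := by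
  have := h.absolutelyContinuous.continuousOn
  rwa [uIcc_of_le zero_le_one] at this

lemma dx_ae (h : HasWeakDeriv f d) : AEEq (dx f) d := by
  have h0 : (0 : ℝ) ∈ Icc (0 : ℝ) 1 := left_mem_Icc.2 zero_le_one
  have h1 : (1 : ℝ) ∈ Icc (0 : ℝ) 1 := right_mem_Icc.2 zero_le_one
  refine ae_unitMeasure_iff.2 ?_
  filter_upwards [(h.isL2.intervalIntegrable h0 h1).ae_hasDerivAt_integral] with x hx hx'
  have hI : x ∈ uIcc (0 : ℝ) 1 := by
    rw [uIcc_of_le zero_le_one]; exact Ioo_subset_Icc_self hx'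
  have h2 := (hx hI 0 (by simp)).const_add (f 0)
  rw [dx_eq_deriv hx']
  refine (h2.congr_of_eventuallyEq ?_).deriv
  filter_upwards [Icc_mem_nhds hx'.1 hx'.2] with y hy using h.eq_integral y hy

lemma isH1 (h : HasWeakDeriv f d) : IsH1 f :=
  ⟨h.absolutelyContinuous, h.isL2.ae_eq h.dx_ae.symm⟩

/-- A primitive of a continuous function is differentiable at every point of `[0,1]`, with
one-sided derivatives at the end points. -/
lemma hasDerivWithinAt (h : HasWeakDeriv f d) (hd : ContinuousOn d (Icc (0 : ℝ) 1)) {x : ℝ}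
    (hx : x ∈ Icc (0 : ℝ) 1) : HasDerivWithinAt f (d x) (Icc (0 : ℝ) 1) x := by
  have h0 : (0 : ℝ) ∈ Icc (0 : ℝ) 1 := left_mem_Icc.2 zero_le_one
  have : Fact (x ∈ Icc (0 : ℝ) 1) := ⟨hx⟩
  have := intervalIntegral.integral_hasDerivWithinAt_right (s := Icc (0 : ℝ) 1)
    (t := Icc (0 : ℝ) 1) (h.isL2.intervalIntegrable h0 hx)
    (hd.stronglyMeasurableAtFilter_nhdsWithin measurableSet_Icc x) (hd x hx)
  exact (this.const_add (f 0)).congr (fun y hy => h.eq_integral y hy) (h.eq_integral x hx)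

lemma dx_eqOn (h : HasWeakDeriv f d) (hd : ContinuousOn d (Icc (0 : ℝ) 1)) :
    EqOn (dx f) d (Icc (0 : ℝ) 1) := fun x hx =>
  (h.hasDerivWithinAt hd hx).derivWithin (uniqueDiffOn_Icc zero_lt_one x hx)

lemma isH2 {e : ℝ → ℝ} (h : HasWeakDeriv f d) (hd : HasWeakDeriv d e) : IsH2 f :=
  ⟨h.isH1, (hd.congr (h.dx_eqOn hd.continuousOn).symm (EventuallyEq.refl _ _)).isH1⟩

end HasWeakDeriv

lemma IsH1.hasWeakDeriv {f : ℝ → ℝ} (h : IsH1 f) : HasWeakDeriv f (dx f) where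
  isL2 := h.2
  eq_integral x hx := by
    have hsub : uIcc 0 x ⊆ uIcc (0 : ℝ) 1 := by
      rw [uIcc_of_le hx.1, uIcc_of_le zero_le_one]; exact Icc_subset_Icc le_rfl hx.2
    have h1 := (h.1.mono hsub).integral_deriv_eq_sub
    have h2 : AEEq (dx f) (deriv f) :=
      ae_unitMeasure_iff.2 (Eventually.of_forall fun y hy => dx_eq_deriv hy)
    rw [h2.intervalIntegral_congr hx, h1]
    ring

lemma IsH1.continuousOn {f : ℝ → ℝ} (h : IsH1 f) : ContinuousOn f (Icc (0 : ℝ) 1) :=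
  h.hasWeakDeriv.continuousOn

lemma IsH1.isL2 {f : ℝ → ℝ} (h : IsH1 f) : IsL2 f := by
  obtain ⟨C, hC⟩ := isCompact_Icc.exists_bound_of_continuousOn h.continuousOn
  exact MemLp.of_bound (h.continuousOn.aestronglyMeasurable measurableSet_Icc) C
    ((ae_restrict_iff' measurableSet_Icc).2 (Eventually.of_forall hC))

lemma IsH1.sub {f g : ℝ → ℝ} (hf : IsH1 f) (hg : IsH1 g) : IsH1 (f - g) :=
  (hf.hasWeakDeriv.sub hg.hasWeakDeriv).isH1

lemma IsH1.add {f g : ℝ → ℝ} (hf : IsH1 f) (hg : IsH1 g) : IsH1 (f + g) :=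
  (hf.hasWeakDeriv.add hg.hasWeakDeriv).isH1

lemma IsH1.smul {f : ℝ → ℝ} (a : ℝ) (hf : IsH1 f) : IsH1 (a • f) :=
  (hf.hasWeakDeriv.smul a).isH1

lemma IsH1.dx_sub {f g : ℝ → ℝ} (hf : IsH1 f) (hg : IsH1 g) :
    AEEq (dx (f - g)) (dx f - dx g) :=
  (hf.hasWeakDeriv.sub hg.hasWeakDeriv).dx_ae

lemma IsH1.dx_smul {f : ℝ → ℝ} (a : ℝ) (hf : IsH1 f) : AEEq (dx (a • f)) (a • dx f) :=
  (hf.hasWeakDeriv.smul a).dx_ae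

lemma IsH2.dx_sub {f g : ℝ → ℝ} (hf : IsH2 f) (hg : IsH2 g) :
    EqOn (dx (f - g)) (dx f - dx g) (Icc (0 : ℝ) 1) :=
  (hf.1.hasWeakDeriv.sub hg.1.hasWeakDeriv).dx_eqOn (hf.2.continuousOn.sub hg.2.continuousOn)

lemma IsH2.dx_smul {f : ℝ → ℝ} (a : ℝ) (hf : IsH2 f) :
    EqOn (dx (a • f)) (a • dx f) (Icc (0 : ℝ) 1) :=
  (hf.1.hasWeakDeriv.smul a).dx_eqOn (hf.2.continuousOn.const_smul a)

lemma IsH2.sub {f g : ℝ → ℝ} (hf : IsH2 f) (hg : IsH2 g) : IsH2 (f - g) :=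
  (hf.1.hasWeakDeriv.sub hg.1.hasWeakDeriv).isH2 (hf.2.hasWeakDeriv.sub hg.2.hasWeakDeriv)

lemma IsH2.smul {f : ℝ → ℝ} (a : ℝ) (hf : IsH2 f) : IsH2 (a • f) :=
  (hf.1.hasWeakDeriv.smul a).isH2 (hf.2.hasWeakDeriv.smul a)

lemma AEEq.dx_dx_of_eqOn {f g : ℝ → ℝ} (h : EqOn (dx f) g (Icc (0 : ℝ) 1)) :
    AEEq (dx (dx f)) (dx g) := AEEq.of_eqOn (dx_eqOn_of_eqOn h)

@[simp] lemma State.smul_u (a : ℝ) (X : State) : (a • X).u = a • X.u := rfl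
@[simp] lemma State.smul_ut (a : ℝ) (X : State) : (a • X).ut = a • X.ut := rfl
@[simp] lemma State.smul_v (a : ℝ) (X : State) : (a • X).v = a • X.v := rfl
@[simp] lemma State.smul_vt (a : ℝ) (X : State) : (a • X).vt = a • X.vt := rfl
@[simp] lemma State.sub_u (X Y : State) : (X - Y).u = X.u - Y.u := rfl
@[simp] lemma State.sub_ut (X Y : State) : (X - Y).ut = X.ut - Y.ut := rfl
@[simp] lemma State.sub_v (X Y : State) : (X - Y).v = X.v - Y.v := rfl
@[simp] lemma State.sub_vt (X Y : State) : (X - Y).vt = X.vt - Y.vt := rfl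

namespace GeneratorGraph

variable {c₁ c₂ g h q : ℝ} {X Y X' Y' : State}

lemma smul (a : ℝ) (hX : GeneratorGraph c₁ c₂ g h q X Y) :
    GeneratorGraph c₁ c₂ g h q (a • X) (a • Y) where
  u_mem := hX.u_mem.smul a
  ut_mem := hX.ut_mem.smul a
  v_mem := hX.v_mem.smul a
  vt_mem := hX.vt_mem.smul a
  trace_pos := congrArg (a * ·) hX.trace_pos
  trace_vel := congrArg (a * ·) hX.trace_vel
  bc_u_zero := by
    have := hX.u_mem.dx_smul a (left_mem_Icc.2 zero_le_one)
    have h2 := hX.bc_u_zero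
    simp only [State.smul_u, State.smul_ut, Pi.smul_apply,
      smul_eq_mul] at *
    rw [this, h2]; ring
  bc_interface := by
    have h1 := hX.u_mem.dx_smul a (right_mem_Icc.2 zero_le_one)
    have h2 := hX.v_mem.dx_smul a (left_mem_Icc.2 zero_le_one)
    have h3 := hX.bc_interface
    simp only [State.smul_u, State.smul_v, Pi.smul_apply,
      smul_eq_mul] at *
    rw [h1, h2, h3]
  bc_v_one := by
    have h1 := hX.v_mem.dx_smul a (right_mem_Icc.2 zero_le_one)
    have h3 := hX.bc_v_one
    simp only [State.smul_v, State.smul_vt, Pi.smul_apply,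
      smul_eq_mul] at *
    rw [h1, h3]; ring
  u_eq x hx := congrArg (a * ·) (hX.u_eq hx)
  ut_eq := by
    filter_upwards [hX.ut_eq, AEEq.dx_dx_of_eqOn (hX.u_mem.dx_smul a), hX.u_mem.2.dx_smul a]
      with x h1 h2 h3
    simp only [State.smul_u, State.smul_ut, Pi.smul_apply,
      smul_eq_mul] at *
    rw [h1, h2, h3]; ring
  v_eq x hx := congrArg (a * ·) (hX.v_eq hx)
  vt_eq := by
    filter_upwards [hX.vt_eq, AEEq.dx_dx_of_eqOn (hX.v_mem.dx_smul a), hX.v_mem.2.dx_smul a]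
      with x h1 h2 h3
    simp only [State.smul_v, State.smul_vt, Pi.smul_apply,
      smul_eq_mul] at *
    rw [h1, h2, h3]; ring

lemma sub (hX : GeneratorGraph c₁ c₂ g h q X Y) (hX' : GeneratorGraph c₁ c₂ g h q X' Y') :
    GeneratorGraph c₁ c₂ g h q (X - X') (Y - Y') where
  u_mem := hX.u_mem.sub hX'.u_mem
  ut_mem := hX.ut_mem.sub hX'.ut_mem
  v_mem := hX.v_mem.sub hX'.v_mem
  vt_mem := hX.vt_mem.sub hX'.vt_mem
  trace_pos := congrArg₂ (· - ·) hX.trace_pos hX'.trace_pos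
  trace_vel := congrArg₂ (· - ·) hX.trace_vel hX'.trace_vel
  bc_u_zero := by
    have := hX.u_mem.dx_sub hX'.u_mem (left_mem_Icc.2 zero_le_one)
    have h2 := hX.bc_u_zero
    have h3 := hX'.bc_u_zero
    simp only [State.sub_u, State.sub_ut, Pi.sub_apply] at *
    rw [this, h2, h3]; ring
  bc_interface := by
    have h1 := hX.u_mem.dx_sub hX'.u_mem (right_mem_Icc.2 zero_le_one)
    have h2 := hX.v_mem.dx_sub hX'.v_mem (left_mem_Icc.2 zero_le_one)
    have h3 := hX.bc_interface
    have h4 := hX'.bc_interface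
    simp only [State.sub_u, State.sub_v, Pi.sub_apply] at *
    rw [h1, h2, h3, h4]
  bc_v_one := by
    have h1 := hX.v_mem.dx_sub hX'.v_mem (right_mem_Icc.2 zero_le_one)
    have h3 := hX.bc_v_one
    have h4 := hX'.bc_v_one
    simp only [State.sub_v, State.sub_vt, Pi.sub_apply] at *
    rw [h1, h3, h4]; ring
  u_eq x hx := congrArg₂ (· - ·) (hX.u_eq hx) (hX'.u_eq hx)
  ut_eq := by
    filter_upwards [hX.ut_eq, hX'.ut_eq, AEEq.dx_dx_of_eqOn (hX.u_mem.dx_sub hX'.u_mem),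
      hX.u_mem.2.dx_sub hX'.u_mem.2] with x h1 h1' h2 h3
    simp only [State.sub_u, State.sub_ut, Pi.sub_apply] at *
    rw [h1, h1', h2, h3]; ring
  v_eq x hx := congrArg₂ (· - ·) (hX.v_eq hx) (hX'.v_eq hx)
  vt_eq := by
    filter_upwards [hX.vt_eq, hX'.vt_eq, AEEq.dx_dx_of_eqOn (hX.v_mem.dx_sub hX'.v_mem),
      hX.v_mem.2.dx_sub hX'.v_mem.2] with x h1 h1' h2 h3
    simp only [State.sub_v, State.sub_vt, Pi.sub_apply] at *
    rw [h1, h1', h2, h3]; ring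

end GeneratorGraph

/-! ### States as elements of a Hilbert space -/

/-- The Hilbert space `L²(0,1)`. -/
abbrev L2Space : Type := Lp ℝ 2 unitMeasure

/-- The class of `f` in `L²(0,1)`; it is `0` when `f` is not square integrable. -/
def toL2 (f : ℝ → ℝ) : L2Space :=
  open Classical in if h : IsL2 f then MemLp.toLp f h else 0

lemma toL2_of_isL2 {f : ℝ → ℝ} (h : IsL2 f) : toL2 f = MemLp.toLp f h := dif_pos h

lemma coeFn_toL2 {f : ℝ → ℝ} (h : IsL2 f) : toL2 f =ᵐ[unitMeasure] f := by
  rw [toL2_of_isL2 h]; exact MemLp.coeFn_toLp h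

lemma toL2_congr {f g : ℝ → ℝ} (hf : IsL2 f) (h : AEEq f g) : toL2 f = toL2 g := by
  rw [toL2_of_isL2 hf, toL2_of_isL2 (hf.ae_eq h)]
  exact MemLp.toLp_congr _ _ h

lemma toL2_sub {f g : ℝ → ℝ} (hf : IsL2 f) (hg : IsL2 g) : toL2 (f - g) = toL2 f - toL2 g := by
  rw [toL2_of_isL2 hf, toL2_of_isL2 hg, toL2_of_isL2 (MemLp.sub hf hg)]
  exact MemLp.toLp_sub hf hg

lemma toL2_add {f g : ℝ → ℝ} (hf : IsL2 f) (hg : IsL2 g) : toL2 (f + g) = toL2 f + toL2 g := by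
  rw [toL2_of_isL2 hf, toL2_of_isL2 hg, toL2_of_isL2 (MemLp.add hf hg)]
  exact MemLp.toLp_add hf hg

lemma toL2_smul {f : ℝ → ℝ} (a : ℝ) (hf : IsL2 f) : toL2 (a • f) = a • toL2 f := by
  rw [toL2_of_isL2 hf, toL2_of_isL2 (MemLp.const_smul hf a)]
  exact MemLp.toLp_const_smul a hf

lemma intervalIntegral_eq_unit (f : ℝ → ℝ) : ∫ x in (0 : ℝ)..1, f x = ∫ x, f x ∂unitMeasure := by
  rw [intervalIntegral.integral_of_le zero_le_one, unitMeasure, integral_Icc_eq_integral_Ioc]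

/-- The affine function `x ↦ a + b x`, used as a weight. -/
def affine (a b x : ℝ) : ℝ := a + b * x

lemma memLp_top_affine (a b : ℝ) : MemLp (affine a b) ⊤ unitMeasure := by
  refine MemLp.of_bound (C := |a| + |b|) ?_ ?_
  · exact (Continuous.aestronglyMeasurable (by unfold affine; fun_prop))
  · refine (ae_restrict_iff' measurableSet_Icc).2 (Eventually.of_forall fun x hx => ?_)
    have h1 : |b * x| ≤ |b| := by
      rw [abs_mul, abs_of_nonneg hx.1]
      exact mul_le_of_le_one_right (abs_nonneg b) hx.2
    exact (abs_add_le a (b * x)).trans (by linarith)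

/-- Multiplication by an affine weight, as a bounded operator on `L²(0,1)`. -/
def mulAffine (a b : ℝ) : L2Space →L[ℝ] L2Space :=
  (ContinuousLinearMap.mul ℝ ℝ).holderL unitMeasure ⊤ 2 2 (MemLp.toLp _ (memLp_top_affine a b))

lemma coeFn_mulAffine (a b : ℝ) (f : L2Space) :
    mulAffine a b f =ᵐ[unitMeasure] fun x => affine a b x * f x := by
  have h := ContinuousLinearMap.coeFn_holder (r := 2) (ContinuousLinearMap.mul ℝ ℝ)
    (MemLp.toLp _ (memLp_top_affine a b)) f
  filter_upwards [h, MemLp.coeFn_toLp (memLp_top_affine a b)] with x h1 h2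
  rw [← h2]
  exact h1

lemma inner_mulAffine (a b : ℝ) (f g : L2Space) :
    inner ℝ (mulAffine a b f) g = ∫ x, affine a b x * f x * g x ∂unitMeasure := by
  rw [L2.inner_def]
  refine integral_congr_ae ?_
  filter_upwards [coeFn_mulAffine a b f] with x hx
  rw [hx]
  simp [mul_comm]

lemma inner_mulAffine_comm (a b : ℝ) (f g : L2Space) :
    inner ℝ (mulAffine a b f) g = inner ℝ (mulAffine a b g) f := by
  rw [inner_mulAffine, inner_mulAffine]
  exact integral_congr_ae (Eventually.of_forall fun x => by ring)

lemma inner_mulAffine_toL2 (a b : ℝ) {f g : ℝ → ℝ} (hf : IsL2 f) (hg : IsL2 g) :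
    inner ℝ (mulAffine a b (toL2 f)) (toL2 g) = ∫ x in (0 : ℝ)..1, affine a b x * f x * g x := by
  rw [inner_mulAffine, intervalIntegral_eq_unit]
  refine integral_congr_ae ?_
  filter_upwards [coeFn_toL2 hf, coeFn_toL2 hg] with x h1 h2
  rw [h1, h2]

lemma norm_toL2_sq {f : ℝ → ℝ} (hf : IsL2 f) : ‖toL2 f‖ ^ 2 = l2sq f := by
  rw [← real_inner_self_eq_norm_sq, L2.inner_def, l2sq, intervalIntegral_eq_unit]
  refine integral_congr_ae ?_
  filter_upwards [coeFn_toL2 hf] with x h1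
  rw [h1]
  simp [sq]

lemma AEEq.l2sq_eq {f k : ℝ → ℝ} (h : AEEq f k) : l2sq f = l2sq k :=
  AEEq.intervalIntegral_congr (f := fun x => f x ^ 2) (g := fun x => k x ^ 2)
    (h.mono fun x hx => by simp only [hx]) (right_mem_Icc.2 zero_le_one)

/-- The Hilbert space `L²(0,1)⁶`, which receives `(u, u_x, u_t, v, v_x, v_t)`. -/
abbrev JetSpace : Type := PiLp 2 (fun _ : Fin 6 => L2Space)

/-- The state `(u, u_t, v, v_t)` as the element `(u, u_x, u_t, v, v_x, v_t)` of `L²(0,1)⁶`. On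
`H¹ × L² × H¹ × L²` this map is linear, and `fullNorm` is the norm of the image. -/
def jet (X : State) : JetSpace :=
  WithLp.toLp 2 ![toL2 X.u, toL2 (dx X.u), toL2 X.ut, toL2 X.v, toL2 (dx X.v), toL2 X.vt]

namespace MemH

variable {X Y : State}

lemma sub (hX : MemH X) (hY : MemH Y) : MemH (X - Y) where
  u_mem := hX.u_mem.sub hY.u_mem
  ut_mem := MemLp.sub hX.ut_mem hY.ut_mem
  v_mem := hX.v_mem.sub hY.v_mem
  vt_mem := MemLp.sub hX.vt_mem hY.vt_mem
  trace := congrArg₂ (· - ·) hX.trace hY.trace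

lemma smul (a : ℝ) (hX : MemH X) : MemH (a • X) where
  u_mem := hX.u_mem.smul a
  ut_mem := MemLp.const_smul hX.ut_mem a
  v_mem := hX.v_mem.smul a
  vt_mem := MemLp.const_smul hX.vt_mem a
  trace := congrArg (a * ·) hX.trace

lemma jet_sub (hX : MemH X) (hY : MemH Y) : jet (X - Y) = jet X - jet Y := by
  have h1 := toL2_congr (hX.sub hY).u_mem.2 (hX.u_mem.dx_sub hY.u_mem)
  have h2 := toL2_congr (hX.sub hY).v_mem.2 (hX.v_mem.dx_sub hY.v_mem)
  rw [toL2_sub hX.u_mem.2 hY.u_mem.2] at h1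
  rw [toL2_sub hX.v_mem.2 hY.v_mem.2] at h2
  ext1 i
  fin_cases i
  · exact toL2_sub hX.u_mem.isL2 hY.u_mem.isL2
  · exact h1
  · exact toL2_sub hX.ut_mem hY.ut_mem
  · exact toL2_sub hX.v_mem.isL2 hY.v_mem.isL2
  · exact h2
  · exact toL2_sub hX.vt_mem hY.vt_mem

lemma jet_smul (a : ℝ) (hX : MemH X) : jet (a • X) = a • jet X := by
  have h1 := toL2_congr (hX.smul a).u_mem.2 (hX.u_mem.dx_smul a)
  have h2 := toL2_congr (hX.smul a).v_mem.2 (hX.v_mem.dx_smul a)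
  rw [toL2_smul a hX.u_mem.2] at h1
  rw [toL2_smul a hX.v_mem.2] at h2
  ext1 i
  fin_cases i
  · exact toL2_smul a hX.u_mem.isL2
  · exact h1
  · exact toL2_smul a hX.ut_mem
  · exact toL2_smul a hX.v_mem.isL2
  · exact h2
  · exact toL2_smul a hX.vt_mem

lemma norm_jet (hX : MemH X) : ‖jet X‖ = fullNorm X := by
  rw [PiLp.norm_eq_of_L2, fullNorm]
  congr 1
  simp only [Fin.sum_univ_six]
  rw [← norm_toL2_sq hX.u_mem.isL2, ← norm_toL2_sq hX.u_mem.2, ← norm_toL2_sq hX.ut_mem,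
    ← norm_toL2_sq hX.v_mem.isL2, ← norm_toL2_sq hX.v_mem.2, ← norm_toL2_sq hX.vt_mem]
  simp only [jet, Matrix.cons_val]
  ring

end MemH

lemma GeneratorGraph.memH {c₁ c₂ g h q : ℝ} {X Y : State} (hX : GeneratorGraph c₁ c₂ g h q X Y) :
    MemH X :=
  ⟨hX.u_mem.1, hX.ut_mem.isL2, hX.v_mem.1, hX.vt_mem.isL2, hX.trace_pos⟩

lemma HasTimeDerivInH.hasDerivWithinAt_jet {X Y : ℝ → State} (h : HasTimeDerivInH Y X)
    (hX : ∀ t, 0 ≤ t → MemH (X t)) (hY : ∀ t, 0 ≤ t → MemH (Y t)) {t : ℝ} (ht : 0 ≤ t) :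
    HasDerivWithinAt (fun s => jet (Y s)) (jet (X t)) (Ici 0) t := by
  rw [hasDerivWithinAt_iff_tendsto_slope, tendsto_iff_norm_sub_tendsto_zero]
  refine (h t ht).congr' ?_
  filter_upwards [self_mem_nhdsWithin] with s hs
  have hd : MemH ((s - t)⁻¹ • (Y s - Y t)) := ((hY s hs.1).sub (hY t ht)).smul _
  rw [slope_def_module, ← (hd.sub (hX t ht)).norm_jet, hd.jet_sub (hX t ht),
    ((hY s hs.1).sub (hY t ht)).jet_smul, (hY s hs.1).jet_sub (hY t ht)]

/-! ### The Lyapunov functional -/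

/-- The weighted square norm `∫₀¹ (a + b x) f(x)² dx`. -/
def weightedSq (a b : ℝ) (f : L2Space) : ℝ := inner ℝ (mulAffine a b f) f

lemma continuous_weightedSq (a b : ℝ) : Continuous (weightedSq a b) := by
  unfold weightedSq; fun_prop

lemma hasDerivWithinAt_weightedSq (a b : ℝ) {f : ℝ → L2Space} {f' : L2Space} {s : Set ℝ} {t : ℝ}
    (hf : HasDerivWithinAt f f' s t) :
    HasDerivWithinAt (fun r => weightedSq a b (f r))
      (2 * inner ℝ (mulAffine a b (f t)) f') s t := by
  have h1 : HasDerivWithinAt (fun r => mulAffine a b (f r)) (mulAffine a b f') s t :=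
    (mulAffine a b).hasFDerivAt.comp_hasDerivWithinAt t hf
  refine (h1.inner ℝ hf).congr_deriv ?_
  rw [inner_mulAffine_comm a b f' (f t)]
  ring

lemma integrable_weighted (a b : ℝ) (f : L2Space) :
    Integrable (fun x => affine a b x * f x * f x) unitMeasure := by
  refine (L2.integrable_inner (𝕜 := ℝ) (mulAffine a b f) f).congr ?_
  filter_upwards [coeFn_mulAffine a b f] with x hx
  rw [hx]
  simp [mul_comm]

lemma norm_sq_eq_weightedSq (f : L2Space) (C : ℝ) : C * ‖f‖ ^ 2 = weightedSq C 0 f := by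
  rw [weightedSq, inner_mulAffine, ← real_inner_self_eq_norm_sq, L2.inner_def,
    ← integral_const_mul]
  refine integral_congr_ae (Eventually.of_forall fun x => ?_)
  simp only [affine, RCLike.inner_apply, conj_trivial]
  ring

lemma weightedSq_mono {a b a' b' : ℝ}
    (h : ∀ x ∈ Icc (0 : ℝ) 1, affine a b x ≤ affine a' b' x) (f : L2Space) :
    weightedSq a b f ≤ weightedSq a' b' f := by
  rw [weightedSq, weightedSq, inner_mulAffine, inner_mulAffine]
  refine integral_mono_ae (integrable_weighted a b f) (integrable_weighted a' b' f) ?_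
  filter_upwards [ae_restrict_mem measurableSet_Icc] with x hx
  have := h x hx
  have h2 := mul_self_nonneg (f x)
  simp only [mul_assoc]
  exact mul_le_mul_of_nonneg_right this h2

lemma weightedSq_left_bounds {κ : ℝ} (hκ : 0 < κ) (f : L2Space) :
    ‖f‖ ^ 2 ≤ weightedSq 1 κ f ∧ weightedSq 1 κ f ≤ (1 + κ) * ‖f‖ ^ 2 := by
  have h1 := norm_sq_eq_weightedSq f 1
  rw [one_mul] at h1
  rw [norm_sq_eq_weightedSq, h1]
  constructor <;> refine weightedSq_mono (fun x hx => ?_) f <;> simp only [affine] <;>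
    nlinarith [hx.1, hx.2]

lemma weightedSq_right_bounds {κ : ℝ} (hκ : 0 < κ) (f : L2Space) :
    ‖f‖ ^ 2 ≤ weightedSq (1 + κ) (-κ) f ∧ weightedSq (1 + κ) (-κ) f ≤ (1 + κ) * ‖f‖ ^ 2 := by
  have h1 := norm_sq_eq_weightedSq f 1
  rw [one_mul] at h1
  rw [norm_sq_eq_weightedSq, h1]
  constructor <;> refine weightedSq_mono (fun x hx => ?_) f <;> simp only [affine] <;>
    nlinarith [hx.1, hx.2]

/-- Integration by parts for one transport equation `ρ_t = c ρ_x` with an affine weight: the change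
of `∫ (a + b x) ρ²` consists of the boundary flux and a bulk term with the sign of `-c b`. -/
lemma two_mul_inner_mulAffine_transport (a b c : ℝ) {ρ σ : ℝ → ℝ} (hρ : IsH1 ρ) (hσ : IsL2 σ)
    (h : AEEq σ (c • dx ρ)) :
    2 * inner ℝ (mulAffine a b (toL2 ρ)) (toL2 σ)
      = c * ((a + b) * ρ 1 ^ 2 - a * ρ 0 ^ 2 - b * ‖toL2 ρ‖ ^ 2) := by
  rw [inner_mulAffine_toL2 a b hρ.isL2 hσ, norm_toL2_sq hρ.isL2, l2sq]
  have hw : AbsolutelyContinuousOnInterval (affine a b) 0 1 :=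
    ContDiffOn.absolutelyContinuousOnInterval
      (by unfold affine; exact ContDiff.contDiffOn (by fun_prop))
  have hF := (hw.fun_mul (hρ.1.fun_mul hρ.1)).integral_deriv_eq_sub
  have hwc : Continuous (affine a b) := by unfold affine; fun_prop
  have hcont : ContinuousOn ρ (uIcc 0 1) := by
    rw [uIcc_of_le zero_le_one]; exact hρ.continuousOn
  have hi1 : IntervalIntegrable (fun x => b * ρ x ^ 2) volume 0 1 :=
    (continuousOn_const.mul (hcont.pow 2)).intervalIntegrable
  have hi2 : IntervalIntegrable (fun x => affine a b x * ρ x * deriv ρ x) volume 0 1 :=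
    hρ.1.intervalIntegrable_deriv.continuousOn_mul (hwc.continuousOn.mul hcont)
  have hsplit : ∫ x in (0 : ℝ)..1, deriv (fun x => affine a b x * (ρ x * ρ x)) x
      = ∫ x in (0 : ℝ)..1, (b * ρ x ^ 2 + 2 * (affine a b x * ρ x * deriv ρ x)) := by
    refine intervalIntegral.integral_congr_ae ?_
    filter_upwards [hρ.1.ae_differentiableAt] with x hx hx'
    have h1 := (hx (uIoc_subset_uIcc hx')).hasDerivAt
    have h2 : HasDerivAt (affine a b) b x := by
      unfold affine; simpa using ((hasDerivAt_id x).const_mul b).const_add a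
    refine (h2.mul (h1.mul h1)).deriv.trans ?_
    simp only [Pi.mul_apply]
    ring
  rw [hF, intervalIntegral.integral_add hi1 (hi2.const_mul 2),
    intervalIntegral.integral_const_mul, intervalIntegral.integral_const_mul] at hsplit
  have hσ' : AEEq (fun x => affine a b x * ρ x * σ x)
      (fun x => c * (affine a b x * ρ x * deriv ρ x)) := by
    have hd : AEEq (dx ρ) (deriv ρ) :=
      ae_unitMeasure_iff.2 (Eventually.of_forall fun y hy => dx_eq_deriv hy)
    filter_upwards [h, hd] with x h1 h2
    rw [h1, Pi.smul_apply, smul_eq_mul, h2]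
    ring
  rw [hσ'.intervalIntegral_congr (right_mem_Icc.2 zero_le_one),
    intervalIntegral.integral_const_mul]
  simp only [affine, mul_one, mul_zero, add_zero] at hsplit ⊢
  linear_combination -c * hsplit

/-- The Riemann invariant `z + c u_x`, as a function of a pair `(u_x, z)`. For `c > 0` it travels to
the left with speed `c` along solutions of `z = u_t`, `u_tt = c² u_xx`; for `-c` in place of `c` it
travels to the right. -/
def riemann (c : ℝ) (p : L2Space) (z : L2Space) : L2Space := z + c • p

/-- The Lyapunov functional: a weighted energy in the four Riemann invariants. The weights increase
in the direction from which the invariant comes. -/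
def energy (c₁ c₂ κ : ℝ) (ξ : JetSpace) : ℝ :=
  ((1 + κ) * c₁ ^ 2)⁻¹ * weightedSq 1 κ (riemann c₁ (ξ 1) (ξ 2))
    + (c₁ ^ 2)⁻¹ * weightedSq (1 + κ) (-κ) (riemann (-c₁) (ξ 1) (ξ 2))
    + (c₂ ^ 2)⁻¹ * weightedSq 1 κ (riemann c₂ (ξ 4) (ξ 5))
    + ((1 + κ) * c₂ ^ 2)⁻¹ * weightedSq (1 + κ) (-κ) (riemann (-c₂) (ξ 4) (ξ 5))

/-- The derivative of `energy` at `ξ` in the direction `ζ`. -/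
def energyDeriv (c₁ c₂ κ : ℝ) (ξ ζ : JetSpace) : ℝ :=
  ((1 + κ) * c₁ ^ 2)⁻¹ * (2 * inner ℝ (mulAffine 1 κ (riemann c₁ (ξ 1) (ξ 2)))
      (riemann c₁ (ζ 1) (ζ 2)))
    + (c₁ ^ 2)⁻¹ * (2 * inner ℝ (mulAffine (1 + κ) (-κ) (riemann (-c₁) (ξ 1) (ξ 2)))
      (riemann (-c₁) (ζ 1) (ζ 2)))
    + (c₂ ^ 2)⁻¹ * (2 * inner ℝ (mulAffine 1 κ (riemann c₂ (ξ 4) (ξ 5)))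
      (riemann c₂ (ζ 4) (ζ 5)))
    + ((1 + κ) * c₂ ^ 2)⁻¹ * (2 * inner ℝ (mulAffine (1 + κ) (-κ) (riemann (-c₂) (ξ 4) (ξ 5)))
      (riemann (-c₂) (ζ 4) (ζ 5)))

lemma continuous_energy (c₁ c₂ κ : ℝ) : Continuous (energy c₁ c₂ κ) := by
  have h1 := continuous_weightedSq 1 κ
  have h2 := continuous_weightedSq (1 + κ) (-κ)
  unfold energy riemann
  fun_prop

lemma hasDerivWithinAt_energy (c₁ c₂ κ : ℝ) {ξ : ℝ → JetSpace} {ζ : JetSpace} {s : Set ℝ} {t : ℝ}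
    (h : HasDerivWithinAt ξ ζ s t) :
    HasDerivWithinAt (fun r => energy c₁ c₂ κ (ξ r)) (energyDeriv c₁ c₂ κ (ξ t) ζ) s t := by
  have hc : ∀ i, HasDerivWithinAt (fun r => ξ r i) (ζ i) s t := fun i =>
    (PiLp.proj (𝕜 := ℝ) 2 (fun _ : Fin 6 => L2Space) i).hasFDerivAt.comp_hasDerivWithinAt t h
  have hr : ∀ (c : ℝ) (i j : Fin 6), HasDerivWithinAt (fun r => riemann c (ξ r i) (ξ r j))
      (riemann c (ζ i) (ζ j)) s t := fun c i j => (hc j).add ((hc i).const_smul c)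
  exact ((((hasDerivWithinAt_weightedSq 1 κ (hr c₁ 1 2)).const_mul _).add
    ((hasDerivWithinAt_weightedSq (1 + κ) (-κ) (hr (-c₁) 1 2)).const_mul _)).add
    ((hasDerivWithinAt_weightedSq 1 κ (hr c₂ 4 5)).const_mul _)).add
    ((hasDerivWithinAt_weightedSq (1 + κ) (-κ) (hr (-c₂) 4 5)).const_mul _)

lemma riemann_toL2 (c : ℝ) {p z : ℝ → ℝ} (hp : IsL2 p) (hz : IsL2 z) :
    riemann c (toL2 p) (toL2 z) = toL2 (z + c • p) := by
  rw [riemann, ← toL2_smul c hp, toL2_add hz (MemLp.const_smul hp c)]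

/-- One Riemann invariant of a state in the domain of the generator satisfies a transport
equation. -/
lemma riemann_transport {c : ℝ} {u z w y : ℝ → ℝ} (hu : IsH2 u) (hz : IsH1 z)
    (hw : EqOn w z (Icc (0 : ℝ) 1)) (hy : AEEq y (fun x => c ^ 2 * dx (dx u) x)) (a b : ℝ) :
    2 * inner ℝ (mulAffine a b (riemann c (toL2 (dx u)) (toL2 z)))
        (riemann c (toL2 (dx w)) (toL2 y))
      = c * ((a + b) * (z 1 + c * dx u 1) ^ 2 - a * (z 0 + c * dx u 0) ^ 2
          - b * ‖riemann c (toL2 (dx u)) (toL2 z)‖ ^ 2) := by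
  have hyL : IsL2 y := (MemLp.const_smul hu.2.2 (c ^ 2)).ae_eq hy.symm
  have hdw : AEEq (dx w) (dx z) := AEEq.of_eqOn (dx_eqOn_of_eqOn hw)
  have hwL : IsL2 (dx w) := hz.2.ae_eq hdw.symm
  rw [riemann_toL2 c hu.2.isL2 hz.isL2, riemann_toL2 c hwL hyL]
  refine two_mul_inner_mulAffine_transport a b c (hz.add (hu.2.smul c))
    (MemLp.add hyL (MemLp.const_smul hwL c)) ?_
  filter_upwards [(hz.hasWeakDeriv.add (hu.2.hasWeakDeriv.smul c)).dx_ae, hdw, hy] with x h1 h2 h3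
  simp only [Pi.add_apply, Pi.smul_apply, smul_eq_mul] at h1 ⊢
  rw [h1, h2, h3]
  ring

/-- The rate at which the Lyapunov functional decays. -/
def decayRate (c₁ c₂ κ : ℝ) : ℝ := κ * min c₁ c₂ / (1 + κ)

/-- Along the generator the Lyapunov functional decays: the boundary terms add up to a nonpositive
number, and the slope `κ` of the weights leaves a multiple of the functional. -/
lemma energyDeriv_le {c₁ c₂ g h κ : ℝ} (hc₁ : 0 < c₁) (hc₂ : 0 < c₂) (hκ : 0 < κ)
    (hg : (1 + κ) ^ 2 * (1 - c₁ * g) ^ 2 ≤ (1 + c₁ * g) ^ 2)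
    (hh : (1 + κ) ^ 2 * (1 - c₂ * h) ^ 2 ≤ (1 + c₂ * h) ^ 2)
    {X Y : State} (hX : GeneratorGraph c₁ c₂ g h 0 X Y) :
    energyDeriv c₁ c₂ κ (jet X) (jet Y)
      ≤ -decayRate c₁ c₂ κ * energy c₁ c₂ κ (jet X) := by
  have hut : AEEq Y.ut (fun x => (-c₁) ^ 2 * dx (dx X.u) x) := by
    simpa only [neg_sq] using hX.ut_eq
  have hvt : AEEq Y.vt (fun x => (-c₂) ^ 2 * dx (dx X.v) x) := by
    simpa only [neg_sq] using hX.vt_eq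
  have e1 := riemann_transport hX.u_mem hX.ut_mem hX.u_eq hX.ut_eq 1 κ
  have e2 := riemann_transport hX.u_mem hX.ut_mem hX.u_eq hut (1 + κ) (-κ)
  have e3 := riemann_transport hX.v_mem hX.vt_mem hX.v_eq hX.vt_eq 1 κ
  have e4 := riemann_transport hX.v_mem hX.vt_mem hX.v_eq hvt (1 + κ) (-κ)
  have b1 := (weightedSq_left_bounds hκ (riemann c₁ (toL2 (dx X.u)) (toL2 X.ut))).2
  have b2 := (weightedSq_right_bounds hκ (riemann (-c₁) (toL2 (dx X.u)) (toL2 X.ut))).2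
  have b3 := (weightedSq_left_bounds hκ (riemann c₂ (toL2 (dx X.v)) (toL2 X.vt))).2
  have b4 := (weightedSq_right_bounds hκ (riemann (-c₂) (toL2 (dx X.v)) (toL2 X.vt))).2
  have p1 := sq_nonneg ‖riemann c₁ (toL2 (dx X.u)) (toL2 X.ut)‖
  have p2 := sq_nonneg ‖riemann (-c₁) (toL2 (dx X.u)) (toL2 X.ut)‖
  have p3 := sq_nonneg ‖riemann c₂ (toL2 (dx X.v)) (toL2 X.vt)‖
  have p4 := sq_nonneg ‖riemann (-c₂) (toL2 (dx X.v)) (toL2 X.vt)‖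
  have hj : ∀ Z : State, jet Z 1 = toL2 (dx Z.u) ∧ jet Z 2 = toL2 Z.ut ∧
      jet Z 4 = toL2 (dx Z.v) ∧ jet Z 5 = toL2 Z.vt := fun Z => ⟨rfl, rfl, rfl, rfl⟩
  rw [energyDeriv, energy, (hj X).1, (hj X).2.1, (hj X).2.2.1, (hj X).2.2.2, (hj Y).1, (hj Y).2.1,
    (hj Y).2.2.1, (hj Y).2.2.2, e1, e2, e3, e4, hX.bc_interface, hX.bc_u_zero, hX.bc_v_one,
    ← hX.trace_vel]
  set N1 := ‖riemann c₁ (toL2 (dx X.u)) (toL2 X.ut)‖ ^ 2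
  set N2 := ‖riemann (-c₁) (toL2 (dx X.u)) (toL2 X.ut)‖ ^ 2
  set N3 := ‖riemann c₂ (toL2 (dx X.v)) (toL2 X.vt)‖ ^ 2
  set N4 := ‖riemann (-c₂) (toL2 (dx X.v)) (toL2 X.vt)‖ ^ 2
  set W1 := weightedSq 1 κ (riemann c₁ (toL2 (dx X.u)) (toL2 X.ut))
  set W2 := weightedSq (1 + κ) (-κ) (riemann (-c₁) (toL2 (dx X.u)) (toL2 X.ut))
  set W3 := weightedSq 1 κ (riemann c₂ (toL2 (dx X.v)) (toL2 X.vt))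
  set W4 := weightedSq (1 + κ) (-κ) (riemann (-c₂) (toL2 (dx X.v)) (toL2 X.vt))
  have hbulk : ∀ c w n : ℝ, min c₁ c₂ ≤ c → w ≤ (1 + κ) * n → 0 ≤ n →
      decayRate c₁ c₂ κ * w ≤ c * κ * n := by
    intro c w n hc hw hn
    have hD : 0 ≤ decayRate c₁ c₂ κ := by
      have := lt_min hc₁ hc₂
      unfold decayRate; positivity
    calc decayRate c₁ c₂ κ * w ≤ decayRate c₁ c₂ κ * ((1 + κ) * n) := by gcongr
      _ = min c₁ c₂ * κ * n := by unfold decayRate; field_simp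
      _ ≤ c * κ * n := by gcongr
  have q1 := mul_le_mul_of_nonneg_left (hbulk c₁ W1 N1 (min_le_left _ _) b1 p1)
    (by positivity : 0 ≤ ((1 + κ) * c₁ ^ 2)⁻¹)
  have q2 := mul_le_mul_of_nonneg_left (hbulk c₁ W2 N2 (min_le_left _ _) b2 p2)
    (by positivity : 0 ≤ (c₁ ^ 2)⁻¹)
  have q3 := mul_le_mul_of_nonneg_left (hbulk c₂ W3 N3 (min_le_right _ _) b3 p3)
    (by positivity : 0 ≤ (c₂ ^ 2)⁻¹)
  have q4 := mul_le_mul_of_nonneg_left (hbulk c₂ W4 N4 (min_le_right _ _) b4 p4)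
    (by positivity : 0 ≤ ((1 + κ) * c₂ ^ 2)⁻¹)
  -- At the interface the four fluxes cancel exactly; the two outer ends give nonpositive squares.
  have hbdry : ∀ a b s e : ℝ,
      ((1 + κ) * c₁ ^ 2)⁻¹ * (c₁ * ((1 + κ) * (s + c₁ * b) ^ 2 - 1 * (a + c₁ * (g * a)) ^ 2))
        + (c₁ ^ 2)⁻¹ * (-c₁ * ((1 + κ + -κ) * (s + -c₁ * b) ^ 2
          - (1 + κ) * (a + -c₁ * (g * a)) ^ 2))
        + (c₂ ^ 2)⁻¹ * (c₂ * ((1 + κ) * (e + c₂ * (-h * e - 0 * X.v 1)) ^ 2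
          - 1 * (s + c₂ * b) ^ 2))
        + ((1 + κ) * c₂ ^ 2)⁻¹ * (-c₂ * ((1 + κ + -κ) * (e + -c₂ * (-h * e - 0 * X.v 1)) ^ 2
          - (1 + κ) * (s + -c₂ * b) ^ 2)) ≤ 0 := by
    intro a b s e
    have r1 := mul_nonneg (mul_nonneg (by positivity : 0 ≤ ((1 + κ) * c₁)⁻¹) (sub_nonneg.2 hg))
      (sq_nonneg a)
    have r2 := mul_nonneg (mul_nonneg (by positivity : 0 ≤ ((1 + κ) * c₂)⁻¹) (sub_nonneg.2 hh))
      (sq_nonneg e)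
    refine le_of_eq_of_le ?_ (neg_nonpos.2 (add_nonneg r1 r2))
    field_simp
    ring
  have hB := hbdry (X.ut 0) (dx X.u 1) (X.ut 1) (X.vt 1)
  linarith

/-! ### Decay of mild solutions -/

lemma le_exp_of_hasDerivWithinAt_le {φ φ' : ℝ → ℝ} {D : ℝ}
    (hφ : ∀ s, 0 ≤ s → HasDerivWithinAt φ (φ' s) (Ici 0) s)
    (hle : ∀ s, 0 ≤ s → φ' s ≤ -D * φ s) {t : ℝ} (ht : 0 ≤ t) :
    φ t ≤ φ 0 * Real.exp (-D * t) := by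
  have hψ : ∀ s, 0 ≤ s → HasDerivWithinAt (fun r => φ r * Real.exp (D * r))
      ((φ' s + D * φ s) * Real.exp (D * s)) (Ici 0) s := by
    intro s hs
    have he : HasDerivAt (fun r => Real.exp (D * r)) (Real.exp (D * s) * D) s := by
      simpa using ((hasDerivAt_id s).const_mul D).exp
    exact ((hφ s hs).mul he.hasDerivWithinAt).congr_deriv (by ring)
  have hanti : AntitoneOn (fun r => φ r * Real.exp (D * r)) (Ici 0) := by
    refine antitoneOn_of_deriv_nonpos (convex_Ici 0) (fun s hs => (hψ s hs).continuousWithinAt)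
      (fun s hs => ?_) fun s hs => ?_
    · rw [interior_Ici] at hs ⊢
      exact ((hψ s hs.le).mono Ioi_subset_Ici_self).differentiableWithinAt
    · rw [interior_Ici] at hs
      rw [((hψ s hs.le).hasDerivAt (Ici_mem_nhds hs)).deriv]
      exact mul_nonpos_of_nonpos_of_nonneg (by linarith [hle s hs.le]) (Real.exp_pos _).le
  have h := hanti (mem_Ici.2 le_rfl) (mem_Ici.2 ht) ht
  simp only [mul_zero, Real.exp_zero, mul_one] at h
  calc φ t = φ t * Real.exp (D * t) * Real.exp (-D * t) := by
        rw [mul_assoc, ← Real.exp_add]; simp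
    _ ≤ φ 0 * Real.exp (-D * t) := by gcongr

/-- `X` is a mild solution and `Y` its primitive, with the time derivative expressed in the Hilbert
space `L²(0,1)⁶`. Unlike `IsSolution` this relation is visibly linear in `(X, Y)`. -/
structure IsMildPair (c₁ c₂ g h q : ℝ) (X Y : ℝ → State) : Prop where
  mem : ∀ t, 0 ≤ t → MemH (X t)
  deriv : ∀ t, 0 ≤ t → HasDerivWithinAt (fun s => jet (Y s)) (jet (X t)) (Ici 0) t
  graph : ∀ t, 0 ≤ t → GeneratorGraph c₁ c₂ g h q (Y t) (X t - X 0)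

lemma IsSolution.exists_isMildPair {c₁ c₂ g h q : ℝ} {X₀ : State} {X : ℝ → State}
    (hX : IsSolution c₁ c₂ g h q X₀ X) :
    ∃ Y, SameState (Y 0) 0 ∧ IsMildPair c₁ c₂ g h q X Y := by
  obtain ⟨Y, h0, hd, hg⟩ := hX.eqn
  exact ⟨Y, h0, hX.mem, fun t ht => hd.hasDerivWithinAt_jet hX.mem (fun s hs => (hg s hs).memH) ht,
    hg⟩

namespace IsMildPair

variable {c₁ c₂ g h q : ℝ} {X Y X' Y' : ℝ → State}

lemma sub (hX : IsMildPair c₁ c₂ g h q X Y) (hX' : IsMildPair c₁ c₂ g h q X' Y') :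
    IsMildPair c₁ c₂ g h q (X - X') (Y - Y') where
  mem t ht := (hX.mem t ht).sub (hX'.mem t ht)
  deriv t ht := by
    have h1 := (hX.deriv t ht).sub (hX'.deriv t ht)
    rw [← (hX.mem t ht).jet_sub (hX'.mem t ht)] at h1
    exact h1.congr (fun s hs => (hX.graph s hs).memH.jet_sub (hX'.graph s hs).memH)
      ((hX.graph t ht).memH.jet_sub (hX'.graph t ht).memH)
  graph t ht := by
    have e : (X - X') t - (X - X') 0 = (X t - X 0) - (X' t - X' 0) := by
      simp only [Pi.sub_apply]; abel
    rw [e]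
    exact (hX.graph t ht).sub (hX'.graph t ht)

/-- The difference quotients of the primitive `Y` are strong solutions, to which `energyDeriv_le`
applies; they converge to `X` as the step tends to zero. -/
lemma energy_le {κ : ℝ} (hc₁ : 0 < c₁) (hc₂ : 0 < c₂) (hκ : 0 < κ)
    (hg : (1 + κ) ^ 2 * (1 - c₁ * g) ^ 2 ≤ (1 + c₁ * g) ^ 2)
    (hh : (1 + κ) ^ 2 * (1 - c₂ * h) ^ 2 ≤ (1 + c₂ * h) ^ 2)
    (hX : IsMildPair c₁ c₂ g h 0 X Y) {t : ℝ} (ht : 0 ≤ t) :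
    energy c₁ c₂ κ (jet (X t))
      ≤ energy c₁ c₂ κ (jet (X 0)) * Real.exp (-decayRate c₁ c₂ κ * t) := by
  have hlim : ∀ s, 0 ≤ s → Tendsto
      (fun δ => energy c₁ c₂ κ (δ⁻¹ • (jet (Y (s + δ)) - jet (Y s)))) (𝓝[>] 0)
      (𝓝 (energy c₁ c₂ κ (jet (X s)))) := by
    intro s hs
    refine ((continuous_energy c₁ c₂ κ).tendsto _).comp ?_
    have h1 := (hasDerivWithinAt_iff_tendsto_slope.1 (hX.deriv s hs))
    have h2 : Tendsto (fun δ : ℝ => s + δ) (𝓝[>] 0) (𝓝[Ici 0 \ {s}] s) := by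
      refine tendsto_nhdsWithin_iff.2 ⟨?_, ?_⟩
      · have : Tendsto (fun δ : ℝ => s + δ) (𝓝 0) (𝓝 (s + 0)) :=
          (continuous_const.add continuous_id).tendsto 0
        rw [add_zero] at this
        exact this.mono_left nhdsWithin_le_nhds
      · filter_upwards [self_mem_nhdsWithin] with δ hδ
        exact ⟨add_nonneg hs (le_of_lt hδ), fun hδ' => (ne_of_gt hδ) (by simpa using hδ')⟩
    refine (h1.comp h2).congr fun δ => ?_
    simp [slope_def_module]
  refine le_of_tendsto_of_tendsto (hlim t ht) ((hlim 0 le_rfl).mul_const _) ?_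
  filter_upwards [self_mem_nhdsWithin] with δ hδ
  have hδ0 : (0 : ℝ) ≤ δ := le_of_lt hδ
  refine le_exp_of_hasDerivWithinAt_le
    (φ := fun s => energy c₁ c₂ κ (δ⁻¹ • (jet (Y (s + δ)) - jet (Y s))))
    (φ' := fun s => energyDeriv c₁ c₂ κ (δ⁻¹ • (jet (Y (s + δ)) - jet (Y s)))
      (δ⁻¹ • (jet (X (s + δ)) - jet (X s)))) (fun s hs => ?_) (fun s hs => ?_) ht
  · refine hasDerivWithinAt_energy c₁ c₂ κ
      ((HasDerivWithinAt.fun_sub ?_ (hX.deriv s hs)).fun_const_smul _)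
    have hshift : HasDerivWithinAt (fun r : ℝ => r + δ) 1 (Ici 0) s :=
      ((hasDerivAt_id s).add_const δ).hasDerivWithinAt
    have := HasDerivWithinAt.scomp s (hX.deriv (s + δ) (add_nonneg hs hδ0)) hshift
      (fun r hr => add_nonneg hr hδ0)
    simpa [Function.comp_def] using this
  · have hs' : 0 ≤ s + δ := add_nonneg hs hδ0
    have hG : GeneratorGraph c₁ c₂ g h 0 (δ⁻¹ • (Y (s + δ) - Y s)) (δ⁻¹ • (X (s + δ) - X s)) := by
      have e : X (s + δ) - X s = (X (s + δ) - X 0) - (X s - X 0) := by abel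
      rw [e]
      exact ((hX.graph _ hs').sub (hX.graph s hs)).smul _
    have hle := energyDeriv_le hc₁ hc₂ hκ hg hh hG
    rwa [((hX.graph _ hs').memH.sub (hX.graph s hs).memH).jet_smul,
      (hX.graph _ hs').memH.jet_sub (hX.graph s hs).memH,
      ((hX.mem _ hs').sub (hX.mem s hs)).jet_smul, (hX.mem _ hs').jet_sub (hX.mem s hs)] at hle

end IsMildPair

lemma norm_riemann_add (c : ℝ) (p z : L2Space) :
    ‖riemann c p z‖ ^ 2 + ‖riemann (-c) p z‖ ^ 2 = 2 * (‖z‖ ^ 2 + c ^ 2 * ‖p‖ ^ 2) := by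
  have h := parallelogram_law_with_norm ℝ z (c • p)
  have e : riemann (-c) p z = z - c • p := by rw [riemann, neg_smul, sub_eq_add_neg]
  rw [e, riemann, h, norm_smul, Real.norm_eq_abs]
  have := sq_abs c
  linear_combination (2 * ‖p‖ ^ 2) * this

lemma seminormH_sq (c₁ c₂ : ℝ) {X : State} (hX : MemH X) :
    2 * seminormH c₁ c₂ X ^ 2
      = (‖riemann c₁ (jet X 1) (jet X 2)‖ ^ 2 + ‖riemann (-c₁) (jet X 1) (jet X 2)‖ ^ 2)
        + (‖riemann c₂ (jet X 4) (jet X 5)‖ ^ 2 + ‖riemann (-c₂) (jet X 4) (jet X 5)‖ ^ 2) := by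
  rw [norm_riemann_add, norm_riemann_add, seminormH, ← norm_toL2_sq hX.u_mem.2,
    ← norm_toL2_sq hX.ut_mem, ← norm_toL2_sq hX.v_mem.2, ← norm_toL2_sq hX.vt_mem,
    Real.sq_sqrt (by positivity)]
  simp only [jet, Matrix.cons_val]
  ring

/-- The Lyapunov functional is bounded below by the square of the seminorm. -/
lemma seminormH_sq_le_energy {c₁ c₂ κ : ℝ} (hc₁ : 0 < c₁) (hc₂ : 0 < c₂) (hκ : 0 < κ) {X : State}
    (hX : MemH X) :
    2 * seminormH c₁ c₂ X ^ 2
      ≤ ((1 + κ) * (c₁ ^ 2 + c₂ ^ 2)) * energy c₁ c₂ κ (jet X) := by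
  rw [seminormH_sq c₁ c₂ hX, energy]
  have key : ∀ (m w n : ℝ), 1 ≤ (1 + κ) * (c₁ ^ 2 + c₂ ^ 2) * m → 0 ≤ n → n ≤ w →
      n ≤ (1 + κ) * (c₁ ^ 2 + c₂ ^ 2) * (m * w) := by
    intro m w n hm hn hw
    rw [← mul_assoc]
    nlinarith
  have hm : ∀ c : ℝ, 0 < c → c ^ 2 ≤ c₁ ^ 2 + c₂ ^ 2 →
      1 ≤ (1 + κ) * (c₁ ^ 2 + c₂ ^ 2) * (c ^ 2)⁻¹ ∧
      1 ≤ (1 + κ) * (c₁ ^ 2 + c₂ ^ 2) * ((1 + κ) * c ^ 2)⁻¹ := by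
    intro c hc hle
    have hc2 : 0 < c ^ 2 := by positivity
    constructor
    · rw [← div_eq_mul_inv, one_le_div hc2]; nlinarith
    · rw [← div_eq_mul_inv, one_le_div (by positivity)]; gcongr
  have m1 := hm c₁ hc₁ (by linarith [sq_nonneg c₂])
  have m2 := hm c₂ hc₂ (by linarith [sq_nonneg c₁])
  have k1 := key _ _ _ m1.2 (sq_nonneg _)
    (weightedSq_left_bounds hκ (riemann c₁ (jet X 1) (jet X 2))).1
  have k2 := key _ _ _ m1.1 (sq_nonneg _)
    (weightedSq_right_bounds hκ (riemann (-c₁) (jet X 1) (jet X 2))).1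
  have k3 := key _ _ _ m2.1 (sq_nonneg _)
    (weightedSq_left_bounds hκ (riemann c₂ (jet X 4) (jet X 5))).1
  have k4 := key _ _ _ m2.2 (sq_nonneg _)
    (weightedSq_right_bounds hκ (riemann (-c₂) (jet X 4) (jet X 5))).1
  linarith

/-- The Lyapunov functional is bounded above by the square of the seminorm. -/
lemma energy_le_seminormH_sq {c₁ c₂ κ : ℝ} (hc₁ : 0 < c₁) (hc₂ : 0 < c₂) (hκ : 0 < κ) {X : State}
    (hX : MemH X) :
    energy c₁ c₂ κ (jet X)
      ≤ ((1 + κ) * ((c₁ ^ 2)⁻¹ + (c₂ ^ 2)⁻¹)) * (2 * seminormH c₁ c₂ X ^ 2) := by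
  rw [seminormH_sq c₁ c₂ hX, energy]
  have key : ∀ (m w n : ℝ), 0 ≤ m → m ≤ (c₁ ^ 2)⁻¹ + (c₂ ^ 2)⁻¹ → 0 ≤ n → w ≤ (1 + κ) * n →
      m * w ≤ (1 + κ) * ((c₁ ^ 2)⁻¹ + (c₂ ^ 2)⁻¹) * n := by
    intro m w n hm0 hm hn hw
    calc m * w ≤ m * ((1 + κ) * n) := by gcongr
      _ ≤ ((c₁ ^ 2)⁻¹ + (c₂ ^ 2)⁻¹) * ((1 + κ) * n) := by gcongr
      _ = _ := by ring
  have hm : ∀ c : ℝ, 0 < c → (c ^ 2)⁻¹ ≤ (c₁ ^ 2)⁻¹ + (c₂ ^ 2)⁻¹ →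
      ((1 + κ) * c ^ 2)⁻¹ ≤ (c₁ ^ 2)⁻¹ + (c₂ ^ 2)⁻¹ := by
    intro c hc hle
    refine le_trans ?_ hle
    have hc2 : 0 < c ^ 2 := by positivity
    exact inv_anti₀ hc2 (by nlinarith)
  have i1 : (0 : ℝ) ≤ (c₁ ^ 2)⁻¹ := by positivity
  have i2 : (0 : ℝ) ≤ (c₂ ^ 2)⁻¹ := by positivity
  have k1 := key _ _ _ (by positivity) (hm c₁ hc₁ (by linarith)) (sq_nonneg _)
    (weightedSq_left_bounds hκ (riemann c₁ (jet X 1) (jet X 2))).2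
  have k2 := key _ _ _ i1 (by linarith) (sq_nonneg _)
    (weightedSq_right_bounds hκ (riemann (-c₁) (jet X 1) (jet X 2))).2
  have k3 := key _ _ _ i2 (by linarith) (sq_nonneg _)
    (weightedSq_left_bounds hκ (riemann c₂ (jet X 4) (jet X 5))).2
  have k4 := key _ _ _ (by positivity) (hm c₂ hc₂ (by linarith)) (sq_nonneg _)
    (weightedSq_right_bounds hκ (riemann (-c₂) (jet X 4) (jet X 5))).2
  linarith

lemma SameState.seminormH_eq {X Y : State} (h : SameState X Y) (c₁ c₂ : ℝ) :
    seminormH c₁ c₂ X = seminormH c₁ c₂ Y := by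
  rw [seminormH, seminormH, h.ut_eq.l2sq_eq, h.vt_eq.l2sq_eq,
    (AEEq.of_eqOn (dx_eqOn_of_eqOn h.u_eq)).l2sq_eq,
    (AEEq.of_eqOn (dx_eqOn_of_eqOn h.v_eq)).l2sq_eq]

/-- The overshoot constant of the exponential bound. -/
def overshoot (c₁ c₂ κ : ℝ) : ℝ :=
  (1 + κ) * (c₁ ^ 2 + c₂ ^ 2) * ((1 + κ) * ((c₁ ^ 2)⁻¹ + (c₂ ^ 2)⁻¹))

lemma one_lt_overshoot {c₁ c₂ κ : ℝ} (hc₁ : 0 < c₁) (hc₂ : 0 < c₂) (hκ : 0 < κ) :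
    1 < overshoot c₁ c₂ κ := by
  have h1 : (c₁ ^ 2 + c₂ ^ 2) * ((c₁ ^ 2)⁻¹ + (c₂ ^ 2)⁻¹)
      = 2 + c₁ ^ 2 * (c₂ ^ 2)⁻¹ + c₂ ^ 2 * (c₁ ^ 2)⁻¹ := by field_simp; ring
  have h2 : 0 < c₁ ^ 2 * (c₂ ^ 2)⁻¹ := by positivity
  have h3 : 0 < c₂ ^ 2 * (c₁ ^ 2)⁻¹ := by positivity
  have h4 : overshoot c₁ c₂ κ
      = (1 + κ) ^ 2 * ((c₁ ^ 2 + c₂ ^ 2) * ((c₁ ^ 2)⁻¹ + (c₂ ^ 2)⁻¹)) := by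
    unfold overshoot; ring
  rw [h4, h1]
  nlinarith

namespace IsMildPair

variable {c₁ c₂ g h : ℝ} {X Y : ℝ → State}

lemma seminormH_le {κ : ℝ} (hc₁ : 0 < c₁) (hc₂ : 0 < c₂) (hκ : 0 < κ)
    (hg : (1 + κ) ^ 2 * (1 - c₁ * g) ^ 2 ≤ (1 + c₁ * g) ^ 2)
    (hh : (1 + κ) ^ 2 * (1 - c₂ * h) ^ 2 ≤ (1 + c₂ * h) ^ 2)
    (hX : IsMildPair c₁ c₂ g h 0 X Y) {t : ℝ} (ht : 0 ≤ t) :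
    seminormH c₁ c₂ (X t) ≤ overshoot c₁ c₂ κ * seminormH c₁ c₂ (X 0)
      * Real.exp (-(decayRate c₁ c₂ κ / 2) * t) := by
  have h1 := seminormH_sq_le_energy hc₁ hc₂ hκ (hX.mem t ht)
  have h2 := energy_le_seminormH_sq hc₁ hc₂ hκ (hX.mem 0 le_rfl)
  have h3 := hX.energy_le hc₁ hc₂ hκ hg hh ht
  have hC := one_lt_overshoot hc₁ hc₂ hκ
  have s0 : 0 ≤ seminormH c₁ c₂ (X 0) := Real.sqrt_nonneg _
  have st : 0 ≤ seminormH c₁ c₂ (X t) := Real.sqrt_nonneg _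
  refine (sq_le_sq₀ st (by positivity)).1 ?_
  have he : Real.exp (-decayRate c₁ c₂ κ * t)
      = Real.exp (-(decayRate c₁ c₂ κ / 2) * t) ^ 2 := by
    rw [← Real.exp_nat_mul]; congr 1; push_cast; ring
  have h4 : 2 * seminormH c₁ c₂ (X t) ^ 2 ≤ overshoot c₁ c₂ κ * (2 * seminormH c₁ c₂ (X 0) ^ 2)
      * Real.exp (-(decayRate c₁ c₂ κ / 2) * t) ^ 2 := by
    rw [← he]
    calc _ ≤ _ := h1
      _ ≤ (1 + κ) * (c₁ ^ 2 + c₂ ^ 2) * (energy c₁ c₂ κ (jet (X 0))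
            * Real.exp (-decayRate c₁ c₂ κ * t)) := by gcongr
      _ ≤ (1 + κ) * (c₁ ^ 2 + c₂ ^ 2) * ((((1 + κ) * ((c₁ ^ 2)⁻¹ + (c₂ ^ 2)⁻¹))
            * (2 * seminormH c₁ c₂ (X 0) ^ 2)) * Real.exp (-decayRate c₁ c₂ κ * t)) := by gcongr
      _ = _ := by unfold overshoot; ring
  have h5 : overshoot c₁ c₂ κ * (seminormH c₁ c₂ (X 0) ^ 2
      * Real.exp (-(decayRate c₁ c₂ κ / 2) * t) ^ 2) ≤ overshoot c₁ c₂ κ ^ 2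
      * (seminormH c₁ c₂ (X 0) ^ 2 * Real.exp (-(decayRate c₁ c₂ κ / 2) * t) ^ 2) := by
    gcongr
    nlinarith
  nlinarith

/-- A mild solution whose initial energy vanishes is stationary. Decay gives `u_t = 0` almost
everywhere, so that `∫₀ᵗ u_t = u(t) - u(0)` is constant in `t`. -/
lemma sameState_of_seminormH_eq_zero {κ : ℝ} (hc₁ : 0 < c₁) (hc₂ : 0 < c₂) (hκ : 0 < κ)
    (hg : (1 + κ) ^ 2 * (1 - c₁ * g) ^ 2 ≤ (1 + c₁ * g) ^ 2)
    (hh : (1 + κ) ^ 2 * (1 - c₂ * h) ^ 2 ≤ (1 + c₂ * h) ^ 2)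
    (hX : IsMildPair c₁ c₂ g h 0 X Y) (hY0 : SameState (Y 0) 0)
    (h0 : seminormH c₁ c₂ (X 0) = 0) {t : ℝ} (ht : 0 ≤ t) :
    EqOn (X t).u (X 0).u (Icc (0 : ℝ) 1) ∧ AEEq (X t).ut 0 ∧
      EqOn (X t).v (X 0).v (Icc (0 : ℝ) 1) ∧ AEEq (X t).vt 0 := by
  have hzero : ∀ s, 0 ≤ s → toL2 (X s).ut = 0 ∧ toL2 (X s).vt = 0 := by
    intro s hs
    have h1 := hX.seminormH_le hc₁ hc₂ hκ hg hh hs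
    rw [h0, mul_zero, zero_mul, seminormH] at h1
    have h2 := Real.sqrt_eq_zero'.1 (le_antisymm h1 (Real.sqrt_nonneg _))
    rw [← norm_toL2_sq (hX.mem s hs).u_mem.2, ← norm_toL2_sq (hX.mem s hs).ut_mem,
      ← norm_toL2_sq (hX.mem s hs).v_mem.2, ← norm_toL2_sq (hX.mem s hs).vt_mem] at h2
    have a1 : 0 ≤ c₁ ^ 2 * ‖toL2 (dx (X s).u)‖ ^ 2 := by positivity
    have a2 : 0 ≤ c₂ ^ 2 * ‖toL2 (dx (X s).v)‖ ^ 2 := by positivity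
    have a3 := sq_nonneg ‖toL2 (X s).ut‖
    have a4 := sq_nonneg ‖toL2 (X s).vt‖
    exact ⟨norm_eq_zero.1 (pow_eq_zero_iff two_ne_zero |>.1 (by linarith)),
      norm_eq_zero.1 (pow_eq_zero_iff two_ne_zero |>.1 (by linarith))⟩
  -- A component of `Y` whose time derivative vanishes stays equal to its initial value.
  have hconst : ∀ i : Fin 6, (∀ s, 0 ≤ s → jet (X s) i = 0) → jet (Y t) i = jet (Y 0) i := by
    intro i hi
    have hd : ∀ s ∈ Ici (0 : ℝ), HasDerivWithinAt (fun r => jet (Y r) i) 0 (Ici 0) s := by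
      intro s hs
      have := (PiLp.proj (𝕜 := ℝ) 2 (fun _ : Fin 6 =>
        L2Space) i).hasFDerivAt.comp_hasDerivWithinAt s (hX.deriv s hs)
      refine this.congr_deriv ?_
      exact hi s hs
    refine ((convex_Ici (0 : ℝ)).is_const_of_fderivWithin_eq_zero (𝕜 := ℝ)
      (fun s hs => (hd s hs).differentiableWithinAt) (fun s hs => ?_) (mem_Ici.2 le_rfl)
      (mem_Ici.2 ht)).symm
    rw [(hd s hs).hasFDerivWithinAt.fderivWithin (uniqueDiffOn_Ici 0 s hs)]
    simp
  -- An `H¹` function that vanishes in `L²` vanishes at every point.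
  have hpt : ∀ {f : ℝ → ℝ}, IsH1 f → toL2 f = 0 → EqOn f 0 (Icc (0 : ℝ) 1) := by
    intro f hf hf0
    have hae : AEEq f 0 := by
      have h1 := coeFn_toL2 hf.isL2
      rw [hf0] at h1
      exact h1.symm.trans (Lp.coeFn_zero _ _ _)
    exact Measure.eqOn_Icc_of_ae_eq volume zero_ne_one hae hf.continuousOn continuousOn_const
  have hae : ∀ {f : ℝ → ℝ}, IsL2 f → toL2 f = 0 → AEEq f 0 := by
    intro f hf hf0
    have h1 := coeFn_toL2 hf
    rw [hf0] at h1
    exact h1.symm.trans (Lp.coeFn_zero _ _ _)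
  have hz : toL2 (0 : ℝ → ℝ) = 0 := by
    rw [toL2_of_isL2 (MemLp.zero (p := 2))]; rfl
  have hG0 := hX.graph 0 le_rfl
  have hG := hX.graph t ht
  have hu : toL2 (Y t).ut = 0 := by
    have e := hconst 2 fun s hs => (hzero s hs).1
    have e0 : toL2 (Y 0).ut = 0 := (toL2_congr hG0.ut_mem.isL2 hY0.ut_eq).trans hz
    exact e.trans e0
  have hv : toL2 (Y t).vt = 0 := by
    have e := hconst 5 fun s hs => (hzero s hs).2
    have e0 : toL2 (Y 0).vt = 0 := (toL2_congr hG0.vt_mem.isL2 hY0.vt_eq).trans hz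
    exact e.trans e0
  refine ⟨fun x hx => ?_, hae (hX.mem t ht).ut_mem (hzero t ht).1, fun x hx => ?_,
    hae (hX.mem t ht).vt_mem (hzero t ht).2⟩
  · exact sub_eq_zero.1 ((hG.u_eq hx).trans (hpt hG.ut_mem hu hx))
  · exact sub_eq_zero.1 ((hG.v_eq hx).trans (hpt hG.vt_mem hv hx))

end IsMildPair

/-- Solutions are unique. -/
lemma IsSolution.unique {c₁ c₂ g h κ : ℝ} (hc₁ : 0 < c₁) (hc₂ : 0 < c₂) (hκ : 0 < κ)
    (hg : (1 + κ) ^ 2 * (1 - c₁ * g) ^ 2 ≤ (1 + c₁ * g) ^ 2)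
    (hh : (1 + κ) ^ 2 * (1 - c₂ * h) ^ 2 ≤ (1 + c₂ * h) ^ 2) {X₀ : State} {X X' : ℝ → State}
    (hX : IsSolution c₁ c₂ g h 0 X₀ X) (hX' : IsSolution c₁ c₂ g h 0 X₀ X') {t : ℝ}
    (ht : 0 ≤ t) : SameState (X t) (X' t) := by
  obtain ⟨Y, hY0, hXY⟩ := hX.exists_isMildPair
  obtain ⟨Y', hY0', hXY'⟩ := hX'.exists_isMildPair
  have hD := hXY.sub hXY'
  have hsub : ∀ {Z Z' W : State}, SameState Z W → SameState Z' W → SameState (Z - Z') 0 := by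
    intro Z Z' W h1 h2
    refine ⟨fun x hx => sub_eq_zero.2 ((h1.u_eq hx).trans (h2.u_eq hx).symm), ?_,
      fun x hx => sub_eq_zero.2 ((h1.v_eq hx).trans (h2.v_eq hx).symm), ?_⟩
    · filter_upwards [h1.ut_eq, h2.ut_eq] with x e1 e2 using sub_eq_zero.2 (e1.trans e2.symm)
    · filter_upwards [h1.vt_eq, h2.vt_eq] with x e1 e2 using sub_eq_zero.2 (e1.trans e2.symm)
  have hD0 : SameState ((X - X') 0) 0 := hsub hX.init hX'.init
  have h0 : seminormH c₁ c₂ ((X - X') 0) = 0 := by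
    rw [hD0.seminormH_eq]
    have hdx : dx (0 : ℝ → ℝ) = 0 := by
      funext x; simp [dx]
    have e2 : State.ut 0 = 0 := rfl
    have e3 : State.v 0 = 0 := rfl
    have e4 : State.vt 0 = 0 := rfl
    simp [seminormH, e2, e3, e4, hdx, l2sq]
  obtain ⟨h1, h2, h3, h4⟩ := hD.sameState_of_seminormH_eq_zero hc₁ hc₂ hκ hg hh
    (hsub hY0 hY0') h0 ht
  refine ⟨fun x hx => sub_eq_zero.1 ((h1 hx).trans (hD0.u_eq hx)), ?_,
    fun x hx => sub_eq_zero.1 ((h3 hx).trans (hD0.v_eq hx)), ?_⟩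
  · filter_upwards [h2] with x e using sub_eq_zero.1 e
  · filter_upwards [h4] with x e using sub_eq_zero.1 e

/-! ### Locally square integrable functions on the line -/

/-- `f` is measurable and square integrable on every bounded interval. -/
structure L2Loc (f : ℝ → ℝ) : Prop where
  measurable : Measurable f
  memLp : ∀ a b, MemLp f 2 (volume.restrict (Icc a b))

/-- The primitive `t ↦ ∫₀ᵗ f`. -/
def prim (f : ℝ → ℝ) (t : ℝ) : ℝ := ∫ s in (0 : ℝ)..t, f s

namespace L2Loc

variable {f k : ℝ → ℝ}

lemma intervalIntegrable (hf : L2Loc f) (a b : ℝ) : IntervalIntegrable f volume a b := by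
  have h : IntegrableOn f (Icc (min a b) (max a b)) := (hf.memLp _ _).integrable (by norm_num)
  exact h.intervalIntegrable

lemma add (hf : L2Loc f) (hk : L2Loc k) : L2Loc (fun t => f t + k t) :=
  ⟨hf.measurable.add hk.measurable, fun a b => (hf.memLp a b).add (hk.memLp a b)⟩

lemma const_mul (c : ℝ) (hf : L2Loc f) : L2Loc (fun t => c * f t) :=
  ⟨hf.measurable.const_mul c, fun a b => (hf.memLp a b).const_mul c⟩

lemma of_continuous (hf : Continuous f) : L2Loc f := by
  refine ⟨hf.measurable, fun a b => ?_⟩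
  obtain ⟨C, hC⟩ := isCompact_Icc.exists_bound_of_continuousOn (hf.continuousOn (s := Icc a b))
  exact MemLp.of_bound hf.aestronglyMeasurable C
    ((ae_restrict_iff' measurableSet_Icc).2 (Eventually.of_forall hC))

lemma ite_neg (hf : L2Loc f) (hk : L2Loc k) : L2Loc (fun t => if t < 0 then f t else k t) := by
  refine ⟨Measurable.ite measurableSet_Iio hf.measurable hk.measurable, fun a b => ?_⟩
  exact MemLp.piecewise (s := Iio 0) measurableSet_Iio ((hf.memLp a b).restrict _)
    ((hk.memLp a b).restrict _)

lemma comp_affine (hf : L2Loc f) {a : ℝ} (ha : a ≠ 0) (t : ℝ) : L2Loc (fun x => f (t + a * x)) := by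
  refine ⟨hf.measurable.comp (by fun_prop), fun p r => ?_⟩
  -- the image of a bounded interval is contained in a bounded interval
  set N : ℝ := |t| + |a| * (|p| + |r|) with hN
  have hg : MemLp ((Icc (-N) N).indicator f) 2 volume :=
    (memLp_indicator_iff_restrict measurableSet_Icc).2 (hf.memLp _ _)
  have hcomp : MemLp (fun x => (Icc (-N) N).indicator f (t + a * x)) 2 volume := by
    have hm : Measure.map (fun x => t + a * x) volume = ENNReal.ofReal |a⁻¹| • volume := by
      have h1 : (fun x => t + a * x) = (fun x => t + x) ∘ (fun x => a * x) := rfl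
      rw [h1, ← Measure.map_map (by fun_prop) (by fun_prop), Real.map_volume_mul_left ha,
        Measure.map_smul, (measurePreserving_add_left volume t).map_eq]
    have h2 : MemLp ((Icc (-N) N).indicator f) 2 (Measure.map (fun x => t + a * x) volume) := by
      rw [hm]; exact hg.smul_measure ENNReal.ofReal_ne_top
    exact h2.comp_of_map (by fun_prop)
  refine (hcomp.restrict (Icc p r)).ae_eq ?_
  filter_upwards [ae_restrict_mem measurableSet_Icc] with x hx
  refine indicator_of_mem ?_ _
  have hx' : |x| ≤ |p| + |r| := by
    rw [abs_le]
    constructor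
    · linarith [hx.1, neg_abs_le p, abs_nonneg r]
    · linarith [hx.2, le_abs_self r, abs_nonneg p]
  have : |t + a * x| ≤ N := by
    calc |t + a * x| ≤ |t| + |a * x| := abs_add_le _ _
      _ ≤ N := by rw [abs_mul, hN]; gcongr
  exact abs_le.1 this

lemma isL2 (hf : L2Loc f) : IsL2 f := hf.memLp 0 1

lemma continuous_prim (hf : L2Loc f) : Continuous (prim f) :=
  intervalIntegral.continuous_primitive hf.intervalIntegrable 0

lemma primitive (hf : L2Loc f) : L2Loc (prim f) := of_continuous hf.continuous_prim

lemma prim_sub_prim (hf : L2Loc f) (a b : ℝ) :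
    prim f b - prim f a = ∫ s in a..b, f s :=
  intervalIntegral.integral_interval_sub_left (hf.intervalIntegrable _ _)
    (hf.intervalIntegrable _ _)

lemma hasWeakDeriv_prim (hf : L2Loc f) {a : ℝ} (ha : a ≠ 0) (t : ℝ) :
    HasWeakDeriv (fun x => prim f (t + a * x)) (fun x => a * f (t + a * x)) where
  isL2 := ((hf.comp_affine ha t).const_mul a).isL2
  eq_integral x _ := by
    have h1 := hf.prim_sub_prim (t + a * 0) (t + a * x)
    rw [intervalIntegral.integral_const_mul, intervalIntegral.mul_integral_comp_add_mul, ← h1]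
    ring

end L2Loc

/-- Every square integrable function on `[0,1]` has a locally square integrable representative. -/
lemma IsL2.exists_l2Loc {f : ℝ → ℝ} (hf : IsL2 f) : ∃ k, L2Loc k ∧ AEEq k f := by
  refine ⟨(Icc (0 : ℝ) 1).indicator (hf.1.mk f),
    ⟨hf.1.stronglyMeasurable_mk.measurable.indicator measurableSet_Icc, fun a b => ?_⟩, ?_⟩
  · refine MemLp.restrict _ ((memLp_indicator_iff_restrict measurableSet_Icc).2 ?_)
    exact hf.ae_eq hf.1.ae_eq_mk
  · filter_upwards [hf.1.ae_eq_mk, ae_restrict_mem measurableSet_Icc] with x h1 h2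
    rw [indicator_of_mem h2, h1]

lemma l2sq_nonneg (f : ℝ → ℝ) : 0 ≤ l2sq f :=
  intervalIntegral.integral_nonneg zero_le_one fun _ _ => sq_nonneg _

lemma l2sq_smul (c : ℝ) (f : ℝ → ℝ) : l2sq (c • f) = c ^ 2 * l2sq f := by
  rw [l2sq, l2sq, ← intervalIntegral.integral_const_mul]
  exact intervalIntegral.integral_congr fun x _ => mul_pow c (f x) 2

lemma l2sq_add_le {f k : ℝ → ℝ} (hf : IsL2 f) (hk : IsL2 k) :
    l2sq (f + k) ≤ 2 * (l2sq f + l2sq k) := by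
  rw [← norm_toL2_sq hf, ← norm_toL2_sq hk, ← norm_toL2_sq (MemLp.add hf hk), toL2_add hf hk]
  have := parallelogram_law_with_norm ℝ (toL2 f) (toL2 k)
  nlinarith [sq_nonneg ‖toL2 f - toL2 k‖]

lemma tendsto_l2sq_add {l : Filter ℝ} {f k : ℝ → ℝ → ℝ} (hf : ∀ s, IsL2 (f s))
    (hk : ∀ s, IsL2 (k s)) (h1 : Tendsto (fun s => l2sq (f s)) l (𝓝 0))
    (h2 : Tendsto (fun s => l2sq (k s)) l (𝓝 0)) :
    Tendsto (fun s => l2sq (f s + k s)) l (𝓝 0) := by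
  refine squeeze_zero (fun s => l2sq_nonneg _) (fun s => l2sq_add_le (hf s) (hk s)) ?_
  simpa using (h1.add h2).const_mul 2

lemma tendsto_l2sq_smul {l : Filter ℝ} {f : ℝ → ℝ → ℝ} (c : ℝ)
    (h : Tendsto (fun s => l2sq (f s)) l (𝓝 0)) :
    Tendsto (fun s => l2sq (c • f s)) l (𝓝 0) := by
  simp only [l2sq_smul]
  simpa using h.const_mul (c ^ 2)

/-- Translation is continuous in `L²`. -/
lemma tendsto_l2sq_translate {f : ℝ → ℝ} (hf : L2Loc f) {a : ℝ} (ha : a ≠ 0) (t : ℝ) :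
    Tendsto (fun s => l2sq (fun x => f (s + a * x) - f (t + a * x))) (𝓝 t) (𝓝 0) := by
  -- Only the values of `f` on a bounded interval matter, so that `f` may be cut off.
  set N : ℝ := |t| + 1 + |a| with hN
  set k := (Icc (-N) N).indicator f with hk
  have hkL : MemLp k 2 volume :=
    (memLp_indicator_iff_restrict measurableSet_Icc).2 (hf.memLp _ _)
  let T : ℝ → Lp ℝ 2 (volume : Measure ℝ) := fun s =>
    Lp.compMeasurePreserving (fun y => s + y) (measurePreserving_add_left volume s) hkL.toLp
  have hT : Continuous T := by
    have hg : Continuous (fun s : ℝ => (⟨fun y => s + y, by fun_prop⟩ : C(ℝ, ℝ))) :=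
      ContinuousMap.continuous_of_continuous_uncurry _ (by
        simp only [Function.uncurry_def, ContinuousMap.coe_mk]; fun_prop)
    exact Continuous.compMeasurePreservingLp (continuous_const (y := hkL.toLp)) hg
      (fun s => measurePreserving_add_left volume s) (by norm_num)
  have hTs : ∀ s, T s =ᵐ[volume] fun y => k (s + y) := fun s =>
    (Lp.coeFn_compMeasurePreserving _ (measurePreserving_add_left volume s)).trans
      ((measurePreserving_add_left volume s).quasiMeasurePreserving.ae_eq_comp hkL.coeFn_toLp)
  have hTn : ∀ s, ‖T s - T t‖ ^ 2 = ∫ y, (k (s + y) - k (t + y)) ^ 2 := by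
    intro s
    rw [← real_inner_self_eq_norm_sq, L2.inner_def]
    refine integral_congr_ae ?_
    filter_upwards [hTs s, hTs t, Lp.coeFn_sub (T s) (T t)] with y h1 h2 h3
    rw [h3, Pi.sub_apply, h1, h2]
    simp [sq]
  have hint : ∀ s, Integrable (fun y => (k (s + y) - k (t + y)) ^ 2) := fun s => by
    have h1 := (L2.integrable_inner (𝕜 := ℝ) (T s - T t) (T s - T t))
    refine h1.congr ?_
    filter_upwards [hTs s, hTs t, Lp.coeFn_sub (T s) (T t)] with y h1 h2 h3
    rw [h3, Pi.sub_apply, h1, h2]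
    simp [sq]
  have hlim : Tendsto (fun s => |a⁻¹| * ‖T s - T t‖ ^ 2) (𝓝 t) (𝓝 0) := by
    have h1 : Tendsto (fun s => T s - T t) (𝓝 t) (𝓝 0) := by
      simpa using (hT.tendsto t).sub_const (T t)
    simpa using (h1.norm.pow 2).const_mul |a⁻¹|
  refine squeeze_zero' (Eventually.of_forall fun s => l2sq_nonneg _) ?_ hlim
  have hnear : ∀ᶠ s in 𝓝 t, |s| ≤ |t| + 1 := by
    have : ∀ᶠ s in 𝓝 t, |s| < |t| + 1 :=
      continuous_abs.continuousAt.eventually_lt continuousAt_const (by linarith)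
    exact this.mono fun s hs => hs.le
  filter_upwards [hnear] with s hs
  have hmem : ∀ r, |r| ≤ |t| + 1 → ∀ x ∈ Icc (0 : ℝ) 1, f (r + a * x) = k (r + a * x) := by
    intro r hr x hx
    refine (indicator_of_mem ?_ _).symm
    have : |r + a * x| ≤ N := by
      calc |r + a * x| ≤ |r| + |a * x| := abs_add_le _ _
        _ ≤ |t| + 1 + |a| := by
          rw [abs_mul, abs_of_nonneg hx.1]
          exact add_le_add hr (mul_le_of_le_one_right (abs_nonneg a) hx.2)
    exact abs_le.1 this
  have hcov : ∫ x, (k (s + a * x) - k (t + a * x)) ^ 2 = |a⁻¹| * ‖T s - T t‖ ^ 2 := by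
    rw [hTn]
    exact Measure.integral_comp_mul_left (fun y => (k (s + y) - k (t + y)) ^ 2) a
  rw [← hcov, l2sq, intervalIntegral_eq_unit]
  have hint' : Integrable (fun x => (k (s + a * x) - k (t + a * x)) ^ 2) :=
    (hint s).comp_mul_left' ha
  calc ∫ x, (f (s + a * x) - f (t + a * x)) ^ 2 ∂unitMeasure
      = ∫ x, (k (s + a * x) - k (t + a * x)) ^ 2 ∂unitMeasure := by
        refine integral_congr_ae ?_
        filter_upwards [ae_restrict_mem measurableSet_Icc] with x hx
        rw [hmem s hs x hx, hmem t (by linarith) x hx]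
    _ ≤ ∫ x, (k (s + a * x) - k (t + a * x)) ^ 2 :=
        setIntegral_le_integral hint' (Eventually.of_forall fun x => sq_nonneg _)

/-- The error of the difference quotient of `prim f` along the line `s ↦ s + a x`. -/
def quotErr (f : ℝ → ℝ) (a t s x : ℝ) : ℝ :=
  (s - t)⁻¹ * (prim f (s + a * x) - prim f (t + a * x)) - f (t + a * x)

lemma L2Loc.isL2_quotErr {f : ℝ → ℝ} (hf : L2Loc f) {a : ℝ} (ha : a ≠ 0) (t s : ℝ) :
    IsL2 (quotErr f a t s) := by
  have h1 := ((hf.primitive.comp_affine ha s).add ((hf.primitive.comp_affine ha t).const_mul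
    (-1))).const_mul (s - t)⁻¹
  have h2 := (h1.add ((hf.comp_affine ha t).const_mul (-1))).isL2
  refine h2.ae_eq (Eventually.of_forall fun x => ?_)
  simp only [quotErr]
  ring

lemma L2Loc.hasWeakDeriv_quotErr {f : ℝ → ℝ} (hf : L2Loc f) {a : ℝ} (ha : a ≠ 0) (t s : ℝ) :
    HasWeakDeriv (quotErr (prim f) a t s) (a • quotErr f a t s) := by
  have h1 := (((hf.primitive.hasWeakDeriv_prim ha s).sub (hf.primitive.hasWeakDeriv_prim ha t)).smul
    (s - t)⁻¹).sub (hf.hasWeakDeriv_prim ha t)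
  refine h1.congr (fun x _ => rfl) (Eventually.of_forall fun x => ?_)
  simp only [quotErr, Pi.sub_apply, Pi.smul_apply, smul_eq_mul]
  ring

lemma sq_integral_le {φ : ℝ → ℝ} (h : IsL2 φ) :
    (∫ r in (0 : ℝ)..1, φ r) ^ 2 ≤ l2sq φ := by
  have hi := h.intervalIntegrable (left_mem_Icc.2 zero_le_one) (right_mem_Icc.2 zero_le_one)
  have hi2 : IntervalIntegrable (fun r => φ r ^ 2) volume 0 1 := by
    rw [intervalIntegrable_iff_integrableOn_Icc_of_le zero_le_one]
    exact MemLp.integrable_sq h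
  set m := ∫ r in (0 : ℝ)..1, φ r with hm
  have h0 : 0 ≤ ∫ r in (0 : ℝ)..1, (φ r - m) ^ 2 :=
    intervalIntegral.integral_nonneg zero_le_one fun _ _ => sq_nonneg _
  have h1 : ∫ r in (0 : ℝ)..1, (φ r - m) ^ 2 = ∫ r in (0 : ℝ)..1, (φ r ^ 2 - 2 * m * φ r + m ^ 2) :=
    intervalIntegral.integral_congr fun r _ => by ring
  rw [h1, intervalIntegral.integral_add (hi2.sub (hi.const_mul _)) intervalIntegrable_const,
    intervalIntegral.integral_sub hi2 (hi.const_mul _), intervalIntegral.integral_const_mul,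
    ← hm, intervalIntegral.integral_const] at h0
  simp only [sub_zero, smul_eq_mul, one_mul] at h0
  unfold l2sq
  nlinarith

/-- The difference quotients of a primitive converge in `L²`: the error is an average of translation
errors, so that Jensen's inequality and Tonelli's theorem apply. -/
lemma tendsto_l2sq_quotErr {f : ℝ → ℝ} (hf : L2Loc f) {a : ℝ} (ha : a ≠ 0) (t : ℝ) :
    Tendsto (fun s => l2sq (quotErr f a t s)) (𝓝[≠] t) (𝓝 0) := by
  have hav : ∀ s, s ≠ t → ∀ x, quotErr f a t s x
      = ∫ r in (0 : ℝ)..1, (f (t + (s - t) * r + a * x) - f (t + a * x)) := by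
    intro s hs x
    have hst : s - t ≠ 0 := sub_ne_zero.2 hs
    have hi : IntervalIntegrable (fun r => f (t + (s - t) * r + a * x)) volume 0 1 := by
      have := (hf.comp_affine hst (t + a * x)).intervalIntegrable 0 1
      refine this.congr (fun r _ => ?_)
      congr 1; ring
    rw [intervalIntegral.integral_sub hi intervalIntegrable_const,
      intervalIntegral.integral_const, quotErr, hf.prim_sub_prim]
    have h1 : ∫ r in (0 : ℝ)..1, f (t + (s - t) * r + a * x)
        = ∫ r in (0 : ℝ)..1, f ((t + a * x) + (s - t) * r) :=
      intervalIntegral.integral_congr fun r _ => by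
        congr 1; ring
    have h2 := intervalIntegral.mul_integral_comp_add_mul (a := 0) (b := 1) (f := f) (s - t)
      (t + a * x)
    rw [h1, eq_inv_mul_iff_mul_eq₀ hst |>.2 h2]
    simp only [mul_zero, add_zero, mul_one, sub_zero, one_smul]
    congr 3
    ring
  refine Metric.tendsto_nhds.2 fun ε hε => ?_
  have htr := Metric.tendsto_nhds.1 (tendsto_l2sq_translate hf ha t) (ε / 2) (half_pos hε)
  obtain ⟨δ, hδ, hball⟩ := Metric.eventually_nhds_iff.1 htr
  have hnear : ∀ᶠ s in 𝓝[≠] t, dist s t < δ :=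
    mem_nhdsWithin_of_mem_nhds (Metric.ball_mem_nhds t hδ)
  filter_upwards [hnear, self_mem_nhdsWithin] with s hs hst
  have hst' : s - t ≠ 0 := sub_ne_zero.2 hst
  rw [Real.dist_eq, sub_zero, abs_of_nonneg (l2sq_nonneg _)]
  refine lt_of_le_of_lt ?_ (half_lt_self hε)
  set E : ℝ → ℝ → ℝ := fun r x => f (t + (s - t) * r + a * x) - f (t + a * x) with hE
  have hEm : Measurable (fun p : ℝ × ℝ => ENNReal.ofReal (E p.1 p.2 ^ 2)) := by
    have := hf.measurable
    refine ENNReal.measurable_ofReal.comp (Measurable.pow_const (Measurable.sub ?_ ?_) 2)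
    · exact this.comp (by fun_prop)
    · exact this.comp (by fun_prop)
  have hEx : ∀ r, IsL2 (E r) := fun r => by
    have := ((hf.comp_affine ha (t + (s - t) * r)).add
      ((hf.comp_affine ha t).const_mul (-1))).isL2
    refine this.ae_eq (Eventually.of_forall fun x => ?_)
    simp only [hE]; ring
  have hEr : ∀ x, IsL2 (fun r => E r x) := fun x => by
    have := ((hf.comp_affine hst' (t + a * x)).add
      (L2Loc.of_continuous (continuous_const (y := -f (t + a * x))))).isL2
    refine this.ae_eq (Eventually.of_forall fun r => ?_)
    simp only [hE]
    rw [sub_eq_add_neg]; congr 2; ring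
  have hl2 : ∀ {φ : ℝ → ℝ}, IsL2 φ →
      ENNReal.ofReal (l2sq φ) = ∫⁻ x, ENNReal.ofReal (φ x ^ 2) ∂unitMeasure := by
    intro φ hφ
    rw [l2sq, intervalIntegral_eq_unit]
    exact ofReal_integral_eq_lintegral_ofReal hφ.integrable_sq
      (Eventually.of_forall fun x => sq_nonneg _)
  have hbound : ∀ r ∈ Icc (0 : ℝ) 1, l2sq (E r) ≤ ε / 2 := by
    intro r hr
    have hd : dist (t + (s - t) * r) t < δ := by
      rw [Real.dist_eq] at hs ⊢
      rw [add_sub_cancel_left, abs_mul, abs_of_nonneg hr.1]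
      exact lt_of_le_of_lt (mul_le_of_le_one_right (abs_nonneg _) hr.2) hs
    have := hball hd
    rw [Real.dist_eq, sub_zero, abs_of_nonneg (l2sq_nonneg _)] at this
    exact this.le
  refine (ENNReal.ofReal_le_ofReal_iff (half_pos hε).le).1 ?_
  calc ENNReal.ofReal (l2sq (quotErr f a t s))
      = ∫⁻ x, ENNReal.ofReal (quotErr f a t s x ^ 2) ∂unitMeasure := hl2 (hf.isL2_quotErr ha t s)
    _ ≤ ∫⁻ x, ∫⁻ r, ENNReal.ofReal (E r x ^ 2) ∂unitMeasure ∂unitMeasure := by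
        refine lintegral_mono fun x => ?_
        rw [← hl2 (hEr x), hav s hst x]
        exact ENNReal.ofReal_le_ofReal (sq_integral_le (hEr x))
    _ = ∫⁻ r, ∫⁻ x, ENNReal.ofReal (E r x ^ 2) ∂unitMeasure ∂unitMeasure :=
        (lintegral_lintegral_swap hEm.aemeasurable).symm
    _ = ∫⁻ r, ENNReal.ofReal (l2sq (E r)) ∂unitMeasure :=
        lintegral_congr fun r => (hl2 (hEx r)).symm
    _ ≤ ∫⁻ _, ENNReal.ofReal (ε / 2) ∂unitMeasure := by
        refine lintegral_mono_ae ?_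
        filter_upwards [ae_restrict_mem measurableSet_Icc] with r hr
        exact ENNReal.ofReal_le_ofReal (hbound r hr)
    _ = ENNReal.ofReal (ε / 2) := by simp

/-! ### Superpositions of a left-going and a right-going wave -/

/-- The position `C + F(t + a x) + K(t - a x)`, where `F`, `K` are the primitives of `f`, `k`. -/
def wavePos (a C : ℝ) (f k : ℝ → ℝ) (t x : ℝ) : ℝ := C + prim f (t + a * x) + prim k (t + -a * x)

/-- The velocity of the wave `wavePos`. -/
def waveVel (a : ℝ) (f k : ℝ → ℝ) (t x : ℝ) : ℝ := f (t + a * x) + k (t + -a * x)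

/-- The slope of the wave `wavePos`. -/
def waveSlope (a : ℝ) (f k : ℝ → ℝ) (t x : ℝ) : ℝ := a * f (t + a * x) - a * k (t + -a * x)

/-- The time primitive `∫₀ᵗ G(s, x) ds`. -/
def timePrim (G : ℝ → ℝ → ℝ) (t x : ℝ) : ℝ := ∫ s in (0 : ℝ)..t, G s x

lemma L2Loc.integral_translate {f : ℝ → ℝ} (hf : L2Loc f) (b t : ℝ) :
    ∫ s in (0 : ℝ)..t, f (s + b) = prim f (t + b) - prim f (0 + b) := by
  rw [hf.prim_sub_prim, intervalIntegral.integral_comp_add_right]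

lemma L2Loc.intervalIntegrable_translate {f : ℝ → ℝ} (hf : L2Loc f) (b p r : ℝ) :
    IntervalIntegrable (fun s => f (s + b)) volume p r := by
  refine ((hf.comp_affine one_ne_zero b).intervalIntegrable p r).congr fun s _ => ?_
  congr 1; ring

section Wave

variable {a : ℝ} {f k : ℝ → ℝ} (C : ℝ)

lemma isL2_waveVel (ha : a ≠ 0) (hf : L2Loc f) (hk : L2Loc k) (t : ℝ) : IsL2 (waveVel a f k t) :=
  ((hf.comp_affine ha t).add (hk.comp_affine (neg_ne_zero.2 ha) t)).isL2

lemma hasWeakDeriv_const (C : ℝ) : HasWeakDeriv (fun _ => C) 0 :=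
  ⟨MemLp.zero, fun x _ => by simp⟩

lemma hasWeakDeriv_wavePos (ha : a ≠ 0) (hf : L2Loc f) (hk : L2Loc k) (t : ℝ) :
    HasWeakDeriv (wavePos a C f k t) (waveSlope a f k t) := by
  refine (((hasWeakDeriv_const C).add (hf.hasWeakDeriv_prim ha t)).add
    (hk.hasWeakDeriv_prim (neg_ne_zero.2 ha) t)).congr (fun x _ => rfl)
    (Eventually.of_forall fun x => ?_)
  simp only [waveSlope, Pi.add_apply, Pi.zero_apply]
  ring

lemma integral_waveVel (hf : L2Loc f) (hk : L2Loc k) (t x : ℝ) :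
    timePrim (waveVel a f k) t x = wavePos a C f k t x - wavePos a C f k 0 x := by
  simp only [timePrim, waveVel, wavePos]
  rw [intervalIntegral.integral_add (hf.intervalIntegrable_translate _ _ _)
    (hk.intervalIntegrable_translate _ _ _), hf.integral_translate, hk.integral_translate]
  ring

lemma timePrim_waveSlope (hf : L2Loc f) (hk : L2Loc k) (t x : ℝ) :
    timePrim (waveSlope a f k) t x = waveSlope a (prim f) (prim k) t x
      - waveSlope a (prim f) (prim k) 0 x := by
  simp only [timePrim, waveSlope]
  rw [intervalIntegral.integral_sub ((hf.intervalIntegrable_translate _ _ _).const_mul a)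
    ((hk.intervalIntegrable_translate _ _ _).const_mul a), intervalIntegral.integral_const_mul,
    intervalIntegral.integral_const_mul, hf.integral_translate, hk.integral_translate]
  ring

lemma timePrim_wavePos (hf : L2Loc f) (hk : L2Loc k) (t x : ℝ) :
    timePrim (wavePos a C f k) t x = C * t + (wavePos a 0 (prim f) (prim k) t x
      - wavePos a 0 (prim f) (prim k) 0 x) := by
  rw [← integral_waveVel 0 hf.primitive hk.primitive]
  simp only [timePrim, waveVel, wavePos, add_assoc]
  rw [intervalIntegral.integral_add intervalIntegrable_const
    ((hf.primitive.intervalIntegrable_translate _ _ _).add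
      (hk.primitive.intervalIntegrable_translate _ _ _)),
    intervalIntegral.integral_const]
  simp [mul_comm]

lemma hasWeakDeriv_timePrim_wavePos (ha : a ≠ 0) (hf : L2Loc f) (hk : L2Loc k) (t : ℝ) :
    HasWeakDeriv (timePrim (wavePos a C f k) t) (timePrim (waveSlope a f k) t) := by
  refine ((hasWeakDeriv_const (C * t)).add
    ((hasWeakDeriv_wavePos 0 ha hf.primitive hk.primitive t).sub
    (hasWeakDeriv_wavePos 0 ha hf.primitive hk.primitive 0))).congr
    (fun x _ => (timePrim_wavePos C hf hk t x).symm) (Eventually.of_forall fun x => ?_)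
  rw [timePrim_waveSlope hf hk]
  simp

lemma hasWeakDeriv_timePrim_waveSlope (ha : a ≠ 0) (hf : L2Loc f) (hk : L2Loc k) (t : ℝ) :
    HasWeakDeriv (timePrim (waveSlope a f k) t)
      (a ^ 2 • (waveVel a f k t - waveVel a f k 0)) := by
  have h1 : ∀ s, HasWeakDeriv (waveSlope a (prim f) (prim k) s) (a ^ 2 • waveVel a f k s) := by
    intro s
    refine (((hf.hasWeakDeriv_prim ha s).smul a).sub
      ((hk.hasWeakDeriv_prim (neg_ne_zero.2 ha) s).smul a)).congr (fun x _ => rfl)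
      (Eventually.of_forall fun x => ?_)
    simp only [waveVel, Pi.sub_apply, Pi.smul_apply, smul_eq_mul]
    ring
  refine ((h1 t).sub (h1 0)).congr (fun x _ => (timePrim_waveSlope hf hk t x).symm)
    (Eventually.of_forall fun x => ?_)
  simp only [Pi.sub_apply, Pi.smul_apply, smul_eq_mul]
  ring

lemma tendsto_l2sq_waveVel (ha : a ≠ 0) (hf : L2Loc f) (hk : L2Loc k) (t : ℝ) :
    Tendsto (fun s => l2sq (waveVel a f k s - waveVel a f k t)) (𝓝 t) (𝓝 0) := by
  have h1 : ∀ {b : ℝ} {p : ℝ → ℝ}, b ≠ 0 → L2Loc p → ∀ s,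
      IsL2 (fun x => p (s + b * x) - p (t + b * x)) := fun hb hp s =>
    MemLp.sub (hp.comp_affine hb s).isL2 (hp.comp_affine hb t).isL2
  refine (tendsto_l2sq_add (h1 ha hf) (h1 (neg_ne_zero.2 ha) hk) (tendsto_l2sq_translate hf ha t)
    (tendsto_l2sq_translate hk (neg_ne_zero.2 ha) t)).congr fun s => ?_
  congr 1
  funext x
  simp only [waveVel, Pi.add_apply, Pi.sub_apply]
  ring

lemma L2Loc.neg {f : ℝ → ℝ} (hf : L2Loc f) : L2Loc (fun t => -f t) := by
  simpa using hf.const_mul (-1)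

lemma tendsto_l2sq_dx_wavePos (ha : a ≠ 0) (hf : L2Loc f) (hk : L2Loc k) (t : ℝ) :
    Tendsto (fun s => l2sq (dx (wavePos a C f k s - wavePos a C f k t))) (𝓝 t) (𝓝 0) := by
  refine (tendsto_l2sq_smul a (tendsto_l2sq_waveVel ha hf hk.neg t)).congr fun s => ?_
  refine AEEq.l2sq_eq (EventuallyEq.trans (Eventually.of_forall fun x => ?_)
    ((hasWeakDeriv_wavePos C ha hf hk s).sub (hasWeakDeriv_wavePos C ha hf hk t)).dx_ae.symm)
  simp only [waveVel, waveSlope, Pi.sub_apply, Pi.smul_apply, smul_eq_mul]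
  ring

lemma tendsto_l2sq_wavePos (ha : a ≠ 0) (hf : L2Loc f) (hk : L2Loc k) (t : ℝ) :
    Tendsto (fun s => l2sq (wavePos a C f k s - wavePos a C f k t)) (𝓝 t) (𝓝 0) := by
  refine (tendsto_l2sq_waveVel ha hf.primitive hk.primitive t).congr fun s => ?_
  congr 1
  funext x
  simp only [waveVel, wavePos, Pi.sub_apply]
  ring

lemma tendsto_l2sq_quotErr_add (ha : a ≠ 0) (hf : L2Loc f) (hk : L2Loc k) (t : ℝ) :
    Tendsto (fun s => l2sq (quotErr f a t s + quotErr k (-a) t s)) (𝓝[≠] t) (𝓝 0) :=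
  tendsto_l2sq_add (hf.isL2_quotErr ha t) (hk.isL2_quotErr (neg_ne_zero.2 ha) t)
    (tendsto_l2sq_quotErr hf ha t) (tendsto_l2sq_quotErr hk (neg_ne_zero.2 ha) t)

lemma tendsto_l2sq_quot_wavePos (ha : a ≠ 0) (hf : L2Loc f) (hk : L2Loc k) (t : ℝ) :
    Tendsto (fun s => l2sq ((s - t)⁻¹ • ((wavePos a C f k s - wavePos a C f k 0)
      - (wavePos a C f k t - wavePos a C f k 0)) - waveVel a f k t)) (𝓝[≠] t) (𝓝 0) := by
  refine (tendsto_l2sq_quotErr_add ha hf hk t).congr fun s => ?_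
  congr 1
  funext x
  simp only [waveVel, wavePos, quotErr, Pi.add_apply, Pi.sub_apply, Pi.smul_apply, smul_eq_mul]
  ring

lemma quot_timePrim_wavePos (hf : L2Loc f) (hk : L2Loc k) {t s : ℝ} (hs : s ≠ t) :
    (s - t)⁻¹ • (timePrim (wavePos a C f k) s - timePrim (wavePos a C f k) t) - wavePos a C f k t
      = quotErr (prim f) a t s + quotErr (prim k) (-a) t s := by
  have hst : s - t ≠ 0 := sub_ne_zero.2 hs
  funext x
  simp only [Pi.add_apply, Pi.sub_apply, Pi.smul_apply, smul_eq_mul, timePrim_wavePos C hf hk]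
  have hC : (s - t)⁻¹ * (C * s - C * t) = C := by field_simp
  simp only [wavePos, quotErr]
  linear_combination hC

lemma tendsto_l2sq_quot_timePrim_wavePos (ha : a ≠ 0) (hf : L2Loc f) (hk : L2Loc k) (t : ℝ) :
    Tendsto (fun s => l2sq ((s - t)⁻¹ • (timePrim (wavePos a C f k) s
      - timePrim (wavePos a C f k) t) - wavePos a C f k t)) (𝓝[≠] t) (𝓝 0) := by
  refine (tendsto_l2sq_quotErr_add ha hf.primitive hk.primitive t).congr' ?_
  filter_upwards [self_mem_nhdsWithin] with s hs
  rw [quot_timePrim_wavePos C hf hk hs]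

lemma tendsto_l2sq_dx_quot_timePrim_wavePos (ha : a ≠ 0) (hf : L2Loc f) (hk : L2Loc k) (t : ℝ) :
    Tendsto (fun s => l2sq (dx ((s - t)⁻¹ • (timePrim (wavePos a C f k) s
      - timePrim (wavePos a C f k) t) - wavePos a C f k t))) (𝓝[≠] t) (𝓝 0) := by
  have h1 := tendsto_l2sq_add (fun s => MemLp.const_smul (hf.isL2_quotErr ha t s) a)
    (fun s => MemLp.const_smul (hk.isL2_quotErr (neg_ne_zero.2 ha) t s) (-a))
    (tendsto_l2sq_smul a (tendsto_l2sq_quotErr hf ha t))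
    (tendsto_l2sq_smul (-a) (tendsto_l2sq_quotErr hk (neg_ne_zero.2 ha) t))
  refine h1.congr' ?_
  filter_upwards [self_mem_nhdsWithin] with s hs
  rw [quot_timePrim_wavePos C hf hk hs]
  exact AEEq.l2sq_eq ((hf.hasWeakDeriv_quotErr ha t s).add
    (hk.hasWeakDeriv_quotErr (neg_ne_zero.2 ha) t s)).dx_ae.symm

end Wave

/-! ### Delay equations -/

/-- One step of the method of steps for `φ i t = ∑ j, M i j φ j (t - τ j)`, `t ≥ 0`. -/
def delayStep (init : Fin 4 → ℝ → ℝ) (M : Matrix (Fin 4) (Fin 4) ℝ) (τ : Fin 4 → ℝ)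
    (φ : Fin 4 → ℝ → ℝ) (i : Fin 4) (t : ℝ) : ℝ :=
  if t < 0 then init i t else ∑ j, M i j * φ j (t - τ j)

lemma l2Loc_delayStep {init : Fin 4 → ℝ → ℝ} (hinit : ∀ i, L2Loc (init i))
    (M : Matrix (Fin 4) (Fin 4) ℝ) (τ : Fin 4 → ℝ) {φ : Fin 4 → ℝ → ℝ} (hφ : ∀ i, L2Loc (φ i))
    (i : Fin 4) : L2Loc (delayStep init M τ φ i) := by
  refine (hinit i).ite_neg ?_
  have h1 : ∀ j, L2Loc (fun t => M i j * φ j (t - τ j)) := fun j => by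
    have := ((hφ j).comp_affine one_ne_zero (-τ j)).const_mul (M i j)
    simpa [sub_eq_neg_add] using this
  simp only [Fin.sum_univ_four]
  exact (((h1 0).add (h1 1)).add (h1 2)).add (h1 3)

/-- A linear delay equation with positive delays has a locally square integrable solution with any
given locally square integrable history: the approximations of the method of steps are eventually
constant on every bounded interval. -/
lemma exists_delay_solution {init : Fin 4 → ℝ → ℝ} (hinit : ∀ i, L2Loc (init i))
    (M : Matrix (Fin 4) (Fin 4) ℝ) {τ : Fin 4 → ℝ} (hτ : ∀ i, 0 < τ i) :
    ∃ φ : Fin 4 → ℝ → ℝ, (∀ i, L2Loc (φ i)) ∧ (∀ i, ∀ t < 0, φ i t = init i t) ∧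
      ∀ i, ∀ t, 0 ≤ t → φ i t = ∑ j, M i j * φ j (t - τ j) := by
  obtain ⟨δ, hδ, hδτ⟩ : ∃ δ : ℝ, 0 < δ ∧ ∀ i, δ ≤ τ i :=
    ⟨Finset.univ.inf' Finset.univ_nonempty τ, (Finset.lt_inf'_iff _).2 fun i _ => hτ i,
      fun i => Finset.inf'_le _ (Finset.mem_univ i)⟩
  set ψ : ℕ → Fin 4 → ℝ → ℝ := fun n => (delayStep init M τ)^[n] init with hψ
  have hsucc : ∀ n, ψ (n + 1) = delayStep init M τ (ψ n) := fun n =>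
    Function.iterate_succ_apply' _ _ _
  have hL : ∀ n i, L2Loc (ψ n i) := by
    intro n
    induction n with
    | zero => exact hinit
    | succ n ih => rw [hsucc]; exact l2Loc_delayStep hinit M τ ih
  have hstep : ∀ (n : ℕ) i t, t < n * δ → ψ (n + 1) i t = ψ n i t := by
    intro n
    induction n with
    | zero =>
      intro i t ht
      rw [hsucc]
      exact if_pos (by simpa using ht)
    | succ n ih =>
      intro i t ht
      have hcongr : ∀ p r : Fin 4 → ℝ → ℝ, (∀ j, p j (t - τ j) = r j (t - τ j)) →
          delayStep init M τ p i t = delayStep init M τ r i t := fun p r hpr => by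
        simp only [delayStep, hpr]
      have h1 := hcongr (ψ (n + 1)) (ψ n) fun j =>
        ih j (t - τ j) (by push_cast at ht; linarith [hδτ j])
      rwa [← hsucc, ← hsucc] at h1
  have hstab : ∀ n m : ℕ, n ≤ m → ∀ i t, t < n * δ → ψ m i t = ψ n i t := by
    intro n m hnm
    induction m, hnm using Nat.le_induction with
    | base => intro i t _; rfl
    | succ m hm ih =>
      intro i t ht
      have hnm' : (n : ℝ) ≤ m := by exact_mod_cast hm
      rw [hstep m i t (lt_of_lt_of_le ht (by gcongr)), ih i t ht]
  set N : ℝ → ℕ := fun t => ⌊t / δ⌋₊ + 1 with hN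
  have hNt : ∀ t, t < N t * δ := by
    intro t
    have := Nat.lt_floor_add_one (t / δ)
    rw [div_lt_iff₀ hδ] at this
    simpa [hN] using this
  have hφψ : ∀ (n : ℕ) i t, t < n * δ → ψ (N t) i t = ψ n i t := by
    intro n i t ht
    rcases le_total n (N t) with h | h
    · exact hstab n (N t) h i t ht
    · exact (hstab (N t) n h i t (hNt t)).symm
  refine ⟨fun i t => ψ (N t) i t, fun i => ⟨?_, fun a b => ?_⟩, fun i t ht => ?_,
    fun i t ht => ?_⟩
  · refine measurable_of_tendsto_metrizable (f := fun n => ψ n i) (fun n => (hL n i).measurable) ?_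
    refine tendsto_pi_nhds.2 fun t => tendsto_const_nhds.congr' ?_
    filter_upwards [eventually_ge_atTop (N t)] with n hn using (hstab (N t) n hn i t (hNt t)).symm
  · refine ((hL (N b) i).memLp a b).ae_eq ?_
    filter_upwards [ae_restrict_mem measurableSet_Icc] with t ht
    exact (hφψ (N b) i t (lt_of_le_of_lt ht.2 (hNt b))).symm
  · exact hφψ 0 i t (by simpa using ht)
  · have h1 : ψ (N t) i t = ψ (N t + 1) i t := (hstep (N t) i t (hNt t)).symm
    simp only
    rw [h1, hsucc, delayStep, if_neg (not_lt.2 ht)]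
    refine Finset.sum_congr rfl fun j _ => ?_
    rw [hφψ (N t) j (t - τ j) (by linarith [hNt t, hτ j])]

/-! ### Existence of solutions -/

lemma tendsto_fullNorm {l : Filter ℝ} {Z : ℝ → State}
    (h1 : Tendsto (fun s => l2sq (Z s).u) l (𝓝 0))
    (h2 : Tendsto (fun s => l2sq (dx (Z s).u)) l (𝓝 0))
    (h3 : Tendsto (fun s => l2sq (Z s).ut) l (𝓝 0))
    (h4 : Tendsto (fun s => l2sq (Z s).v) l (𝓝 0))
    (h5 : Tendsto (fun s => l2sq (dx (Z s).v)) l (𝓝 0))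
    (h6 : Tendsto (fun s => l2sq (Z s).vt) l (𝓝 0)) :
    Tendsto (fun s => fullNorm (Z s)) l (𝓝 0) := by
  have h := ((((h1.add h2).add h3).add (h4.add h5)).add h6)
  simpa [fullNorm, Function.comp_def] using (Real.continuous_sqrt.tendsto _).comp h

/-- Splitting of the initial data of one string into halves of its two Riemann invariants. -/
lemma exists_riemann_split {z w : ℝ → ℝ} (hz : IsL2 z) (hw : IsL2 w) :
    ∃ r p : ℝ → ℝ, L2Loc r ∧ L2Loc p ∧ AEEq (fun x => r x + p x) z ∧
      AEEq (fun x => r x - p x) w := by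
  obtain ⟨z', hz', hzz⟩ := hz.exists_l2Loc
  obtain ⟨w', hw', hww⟩ := hw.exists_l2Loc
  refine ⟨fun x => 2⁻¹ * (z' x + w' x), fun x => 2⁻¹ * (z' x + -1 * w' x),
    (hz'.add hw').const_mul _, (hz'.add (hw'.const_mul (-1))).const_mul _, ?_, ?_⟩
  · filter_upwards [hzz] with x e1
    rw [← e1]; ring
  · filter_upwards [hww] with x e1
    rw [← e1]; ring

/-- A wave whose boundary traces continue the history read off from the initial data starts from
these initial data. -/
lemma wave_initial {c : ℝ} (hc : 0 < c) {u z r p R P : ℝ → ℝ} (hu : IsH1 u)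
    (hR : L2Loc R) (hP : L2Loc P)
    (hz : AEEq (fun x => r x + p x) z) (hdu : AEEq (fun x => r x - p x) (fun x => c * dx u x))
    (hRr : ∀ s < 0, R s = r (1 + c * s)) (hPp : ∀ s < 0, P s = p (0 + -c * s)) :
    EqOn (wavePos c⁻¹ (u 0) (fun s => R (s - c⁻¹)) P 0) u (Icc (0 : ℝ) 1) ∧
      AEEq (waveVel c⁻¹ (fun s => R (s - c⁻¹)) P 0) z := by
  have hc' : 0 < c⁻¹ := inv_pos.2 hc
  have hR' : L2Loc (fun s => R (s - c⁻¹)) := by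
    have := hR.comp_affine one_ne_zero (-c⁻¹)
    simpa [sub_eq_neg_add] using this
  have hval : ∀ᵐ x ∂unitMeasure, R (0 + c⁻¹ * x - c⁻¹) = r x ∧ P (0 + -c⁻¹ * x) = p x := by
    refine ae_unitMeasure_iff.2 (Eventually.of_forall fun x hx => ⟨?_, ?_⟩)
    · have hneg : 0 + c⁻¹ * x - c⁻¹ < 0 := by nlinarith [hx.2]
      rw [hRr _ hneg]
      congr 1
      field_simp
      ring
    · have hneg : 0 + -c⁻¹ * x < 0 := by nlinarith [hx.1]
      rw [hPp _ hneg]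
      congr 1
      field_simp
      ring
  constructor
  · have h1 := hasWeakDeriv_wavePos (u 0) hc'.ne' hR' hP 0
    have hs : AEEq (waveSlope c⁻¹ (fun s => R (s - c⁻¹)) P 0) (dx u) := by
      filter_upwards [hval, hdu] with x h2 h3
      simp only [waveSlope]
      rw [h2.1, h2.2, ← mul_sub, h3]
      field_simp
    intro x hx
    rw [h1.eq_integral x hx, hu.hasWeakDeriv.eq_integral x hx, hs.intervalIntegral_congr hx]
    simp [wavePos, prim]
  · filter_upwards [hval, hz] with x h2 h3
    simp only [waveVel]
    rw [h2.1, h2.2, h3]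

lemma timePrim_congr {G G' : ℝ → ℝ → ℝ} {t x x' : ℝ} (ht : 0 ≤ t)
    (h : ∀ s, 0 ≤ s → G s x = G' s x') : timePrim G t x = timePrim G' t x' := by
  refine intervalIntegral.integral_congr fun s hs => h s ?_
  rw [uIcc_of_le ht] at hs
  exact hs.1

lemma timePrim_const_mul (b : ℝ) (G : ℝ → ℝ → ℝ) (t x : ℝ) :
    timePrim (fun s y => b * G s y) t x = b * timePrim G t x :=
  intervalIntegral.integral_const_mul _ _

/-- A pair of waves that satisfies the interface and boundary conditions for all positive times, in
terms of velocities and slopes, gives a mild solution. -/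
lemma isSolution_of_waves {c₁ c₂ g h : ℝ} (hc₁ : 0 < c₁) (hc₂ : 0 < c₂) {X₀ : State}
    {f₁ k₁ f₂ k₂ : ℝ → ℝ} (hf₁ : L2Loc f₁) (hk₁ : L2Loc k₁) (hf₂ : L2Loc f₂) (hk₂ : L2Loc k₂)
    {C₁ C₂ : ℝ} {X : ℝ → State}
    (hX : X = fun t => (wavePos c₁⁻¹ C₁ f₁ k₁ t, waveVel c₁⁻¹ f₁ k₁ t,
      wavePos c₂⁻¹ C₂ f₂ k₂ t, waveVel c₂⁻¹ f₂ k₂ t))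
    (hinit : SameState (X 0) X₀) (htrace : X₀.u 1 = X₀.v 0)
    (hvel : ∀ s, 0 ≤ s → waveVel c₁⁻¹ f₁ k₁ s 1 = waveVel c₂⁻¹ f₂ k₂ s 0)
    (hslope : ∀ s, 0 ≤ s → waveSlope c₂⁻¹ f₂ k₂ s 0 = waveSlope c₁⁻¹ f₁ k₁ s 1)
    (hleft : ∀ s, 0 ≤ s → waveSlope c₁⁻¹ f₁ k₁ s 0 = g * waveVel c₁⁻¹ f₁ k₁ s 0)
    (hright : ∀ s, 0 ≤ s → waveSlope c₂⁻¹ f₂ k₂ s 1 = -h * waveVel c₂⁻¹ f₂ k₂ s 1) :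
    IsSolution c₁ c₂ g h 0 X₀ X := by
  have a₁ : c₁⁻¹ ≠ 0 := (inv_pos.2 hc₁).ne'
  have a₂ : c₂⁻¹ ≠ 0 := (inv_pos.2 hc₂).ne'
  have h0 : (0 : ℝ) ∈ Icc (0 : ℝ) 1 := left_mem_Icc.2 zero_le_one
  have h1 : (1 : ℝ) ∈ Icc (0 : ℝ) 1 := right_mem_Icc.2 zero_le_one
  have hU : ∀ t, (X t).u = wavePos c₁⁻¹ C₁ f₁ k₁ t := fun t => by rw [hX]
  have hUt : ∀ t, (X t).ut = waveVel c₁⁻¹ f₁ k₁ t := fun t => by rw [hX]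
  have hV : ∀ t, (X t).v = wavePos c₂⁻¹ C₂ f₂ k₂ t := fun t => by rw [hX]
  have hVt : ∀ t, (X t).vt = waveVel c₂⁻¹ f₂ k₂ t := fun t => by rw [hX]
  -- The positions match at the interface since the velocities and the initial positions do.
  have hcompat : ∀ t, 0 ≤ t → wavePos c₁⁻¹ C₁ f₁ k₁ t 1 = wavePos c₂⁻¹ C₂ f₂ k₂ t 0 := by
    intro t ht
    have e1 := integral_waveVel (a := c₁⁻¹) C₁ hf₁ hk₁ t 1
    have e2 := integral_waveVel (a := c₂⁻¹) C₂ hf₂ hk₂ t 0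
    have e3 := timePrim_congr ht hvel
    have e4 : wavePos c₁⁻¹ C₁ f₁ k₁ 0 1 = wavePos c₂⁻¹ C₂ f₂ k₂ 0 0 := by
      rw [← hU, ← hV, hinit.u_eq h1, hinit.v_eq h0, htrace]
    linarith
  let Y : ℝ → State := fun t => (timePrim (wavePos c₁⁻¹ C₁ f₁ k₁) t,
    wavePos c₁⁻¹ C₁ f₁ k₁ t - wavePos c₁⁻¹ C₁ f₁ k₁ 0,
    timePrim (wavePos c₂⁻¹ C₂ f₂ k₂) t, wavePos c₂⁻¹ C₂ f₂ k₂ t - wavePos c₂⁻¹ C₂ f₂ k₂ 0)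
  refine ⟨fun t ht => ⟨?_, ?_, ?_, ?_, ?_⟩, hinit, fun t _ => ?_, Y, ?_, fun t _ => ?_,
    fun t ht => ?_⟩
  · rw [hU]; exact (hasWeakDeriv_wavePos C₁ a₁ hf₁ hk₁ t).isH1
  · rw [hUt]; exact isL2_waveVel a₁ hf₁ hk₁ t
  · rw [hV]; exact (hasWeakDeriv_wavePos C₂ a₂ hf₂ hk₂ t).isH1
  · rw [hVt]; exact isL2_waveVel a₂ hf₂ hk₂ t
  · rw [hU, hV]; exact hcompat t ht
  · subst hX
    refine Tendsto.mono_left ?_ (nhdsWithin_le_nhds (s := Ici 0))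
    exact tendsto_fullNorm (tendsto_l2sq_wavePos C₁ a₁ hf₁ hk₁ t)
      (tendsto_l2sq_dx_wavePos C₁ a₁ hf₁ hk₁ t) (tendsto_l2sq_waveVel a₁ hf₁ hk₁ t)
      (tendsto_l2sq_wavePos C₂ a₂ hf₂ hk₂ t)
      (tendsto_l2sq_dx_wavePos C₂ a₂ hf₂ hk₂ t) (tendsto_l2sq_waveVel a₂ hf₂ hk₂ t)
  · refine ⟨fun x _ => ?_, Eventually.of_forall fun x => ?_, fun x _ => ?_,
      Eventually.of_forall fun x => ?_⟩
    · exact intervalIntegral.integral_same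
    · exact sub_self _
    · exact intervalIntegral.integral_same
    · exact sub_self _
  · subst hX
    refine Tendsto.mono_left ?_ (nhdsWithin_mono t (fun s hs => hs.2 : Ici 0 \ {t} ⊆ {t}ᶜ))
    exact tendsto_fullNorm (tendsto_l2sq_quot_timePrim_wavePos C₁ a₁ hf₁ hk₁ t)
      (tendsto_l2sq_dx_quot_timePrim_wavePos C₁ a₁ hf₁ hk₁ t)
      (tendsto_l2sq_quot_wavePos C₁ a₁ hf₁ hk₁ t)
      (tendsto_l2sq_quot_timePrim_wavePos C₂ a₂ hf₂ hk₂ t)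
      (tendsto_l2sq_dx_quot_timePrim_wavePos C₂ a₂ hf₂ hk₂ t)
      (tendsto_l2sq_quot_wavePos C₂ a₂ hf₂ hk₂ t)
  · have w₁ := hasWeakDeriv_timePrim_wavePos C₁ a₁ hf₁ hk₁ t
    have w₂ := hasWeakDeriv_timePrim_wavePos C₂ a₂ hf₂ hk₂ t
    have s₁ := hasWeakDeriv_timePrim_waveSlope a₁ hf₁ hk₁ t
    have s₂ := hasWeakDeriv_timePrim_waveSlope a₂ hf₂ hk₂ t
    have d₁ := w₁.dx_eqOn s₁.continuousOn
    have d₂ := w₂.dx_eqOn s₂.continuousOn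
    have hdd : ∀ {c : ℝ} {y w e : ℝ → ℝ}, 0 < c → EqOn (dx y) w (Icc (0 : ℝ) 1) →
        HasWeakDeriv w (c⁻¹ ^ 2 • e) → AEEq e (fun x => c ^ 2 * dx (dx y) x) := by
      intro c y w e hc hd hw
      filter_upwards [AEEq.dx_dx_of_eqOn hd, hw.dx_ae] with x e1 e2
      rw [e1, e2, Pi.smul_apply, smul_eq_mul]
      field_simp
    refine ⟨w₁.isH2 s₁, ?_, w₂.isH2 s₂, ?_, ?_, ?_, ?_, ?_, ?_, ?_, ?_, ?_, ?_⟩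
    · exact ((hasWeakDeriv_wavePos C₁ a₁ hf₁ hk₁ t).sub
        (hasWeakDeriv_wavePos C₁ a₁ hf₁ hk₁ 0)).isH1
    · exact ((hasWeakDeriv_wavePos C₂ a₂ hf₂ hk₂ t).sub
        (hasWeakDeriv_wavePos C₂ a₂ hf₂ hk₂ 0)).isH1
    · exact timePrim_congr ht hcompat
    · exact congrArg₂ (· - ·) (hcompat t ht) (hcompat 0 le_rfl)
    · refine (d₁ h0).trans ((timePrim_congr
        (G' := fun s y => g * waveVel c₁⁻¹ f₁ k₁ s y) ht hleft).trans ?_)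
      exact (timePrim_const_mul g (waveVel c₁⁻¹ f₁ k₁) t 0).trans
        (congrArg (g * ·) (integral_waveVel C₁ hf₁ hk₁ t 0))
    · exact (d₂ h0).trans ((timePrim_congr ht hslope).trans (d₁ h1).symm)
    · refine (d₂ h1).trans ((timePrim_congr
        (G' := fun s y => -h * waveVel c₂⁻¹ f₂ k₂ s y) ht hright).trans ?_)
      rw [zero_mul, sub_zero]
      exact (timePrim_const_mul (-h) (waveVel c₂⁻¹ f₂ k₂) t 1).trans
        (congrArg (-h * ·) (integral_waveVel C₂ hf₂ hk₂ t 1))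
    · intro x _; subst hX; rfl
    · subst hX; exact hdd hc₁ d₁ s₁
    · intro x _; subst hX; rfl
    · subst hX; exact hdd hc₂ d₂ s₂

/-- Reflection and transmission coefficients. The unknowns are the boundary values of halves of the
Riemann invariants where they leave an end point: the left-going and right-going ones of the first
string at `x = 1` and `x = 0`, then those of the second string. -/
def scattering (c₁ c₂ g h : ℝ) : Matrix (Fin 4) (Fin 4) ℝ :=
  !![0, (c₂ - c₁) / (c₁ + c₂), 2 * c₁ / (c₁ + c₂), 0;
     (1 - c₁ * g) / (1 + c₁ * g), 0, 0, 0;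
     0, 0, 0, (1 - c₂ * h) / (1 + c₂ * h);
     0, 2 * c₂ / (c₁ + c₂), (c₁ - c₂) / (c₁ + c₂), 0]

/-- Every initial state in `𝓗` is the initial value of a mild solution: the traces of the Riemann
invariants solve a delay equation whose delays are the travel times `1 / c₁` and `1 / c₂`. -/
theorem exists_isSolution {c₁ c₂ g h : ℝ} (hc₁ : 0 < c₁) (hc₂ : 0 < c₂) (hg : 0 < g) (hh : 0 < h)
    {X₀ : State} (hX₀ : MemH X₀) : ∃ X, IsSolution c₁ c₂ g h 0 X₀ X := by
  obtain ⟨r₁, p₁, hr₁, hp₁, hz₁, hd₁⟩ := exists_riemann_split hX₀.ut_mem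
    (MemLp.const_smul hX₀.u_mem.2 c₁)
  obtain ⟨r₂, p₂, hr₂, hp₂, hz₂, hd₂⟩ := exists_riemann_split hX₀.vt_mem
    (MemLp.const_smul hX₀.v_mem.2 c₂)
  let init : Fin 4 → ℝ → ℝ := ![fun s => r₁ (1 + c₁ * s), fun s => p₁ (0 + -c₁ * s),
    fun s => r₂ (1 + c₂ * s), fun s => p₂ (0 + -c₂ * s)]
  have hinit : ∀ i, L2Loc (init i) := by
    intro i
    fin_cases i
    · exact hr₁.comp_affine hc₁.ne' 1
    · exact hp₁.comp_affine (neg_ne_zero.2 hc₁.ne') 0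
    · exact hr₂.comp_affine hc₂.ne' 1
    · exact hp₂.comp_affine (neg_ne_zero.2 hc₂.ne') 0
  have hτ : ∀ i, 0 < (![c₁⁻¹, c₁⁻¹, c₂⁻¹, c₂⁻¹] : Fin 4 → ℝ) i := by
    intro i
    fin_cases i
    · exact inv_pos.2 hc₁
    · exact inv_pos.2 hc₁
    · exact inv_pos.2 hc₂
    · exact inv_pos.2 hc₂
  obtain ⟨φ, hφ, hneg, hpos⟩ := exists_delay_solution hinit (scattering c₁ c₂ g h) hτ
  have hshift : ∀ i b, L2Loc (fun s => φ i (s - b)) := fun i b => by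
    have := (hφ i).comp_affine one_ne_zero (-b)
    simpa [sub_eq_neg_add] using this
  obtain ⟨hu, hut⟩ := wave_initial hc₁ hX₀.u_mem (hφ 0) (hφ 1) hz₁ hd₁ (hneg 0) (hneg 1)
  obtain ⟨hv, hvt⟩ := wave_initial hc₂ hX₀.v_mem (hφ 2) (hφ 3) hz₂ hd₂ (hneg 2) (hneg 3)
  have e0 : ∀ s, 0 ≤ s → φ 0 s = (c₂ - c₁) / (c₁ + c₂) * φ 1 (s - c₁⁻¹)
      + 2 * c₁ / (c₁ + c₂) * φ 2 (s - c₂⁻¹) := fun s hs => by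
    rw [hpos 0 s hs]; simp [scattering, Fin.sum_univ_four]
  have e1 : ∀ s, 0 ≤ s → φ 1 s = (1 - c₁ * g) / (1 + c₁ * g) * φ 0 (s - c₁⁻¹) := fun s hs => by
    rw [hpos 1 s hs]; simp [scattering, Fin.sum_univ_four]
  have e2 : ∀ s, 0 ≤ s → φ 2 s = (1 - c₂ * h) / (1 + c₂ * h) * φ 3 (s - c₂⁻¹) := fun s hs => by
    rw [hpos 2 s hs]; simp [scattering, Fin.sum_univ_four]
  have e3 : ∀ s, 0 ≤ s → φ 3 s = 2 * c₂ / (c₁ + c₂) * φ 1 (s - c₁⁻¹)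
      + (c₁ - c₂) / (c₁ + c₂) * φ 2 (s - c₂⁻¹) := fun s hs => by
    rw [hpos 3 s hs]; simp [scattering, Fin.sum_univ_four]
  have t0 : ∀ a s : ℝ, s + a * 0 = s := fun a s => by ring
  have t1 : ∀ a s : ℝ, s + a * 1 - a = s := fun a s => by ring
  have t2 : ∀ a s : ℝ, s + -a * 1 = s - a := fun a s => by ring
  have n1 : 1 + c₁ * g ≠ 0 := by positivity
  have n2 : 1 + c₂ * h ≠ 0 := by positivity
  have n3 : c₁ + c₂ ≠ 0 := by positivity
  refine ⟨_, isSolution_of_waves hc₁ hc₂ (hshift 0 c₁⁻¹) (hφ 1) (hshift 2 c₂⁻¹) (hφ 3) rfl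
    ⟨hu, hut, hv, hvt⟩ hX₀.trace (fun s hs => ?_) (fun s hs => ?_) (fun s hs => ?_)
    (fun s hs => ?_)⟩
  · simp only [waveVel, t0, t1, t2]
    rw [e0 s hs, e3 s hs]
    field_simp
    ring
  · simp only [waveSlope, t0, t1, t2]
    rw [e0 s hs, e3 s hs]
    field_simp
    ring
  · simp only [waveSlope, waveVel, t0]
    rw [e1 s hs]
    field_simp
    ring
  · simp only [waveSlope, waveVel, t1, t2]
    rw [e2 s hs]
    field_simp
    ring

/-! ### The linear matrix inequality -/

/-- A small slope of the weights does not spoil the strict damping at the two outer ends. -/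
lemma exists_slope {x y : ℝ} (hx : 0 < x) (hy : 0 < y) :
    ∃ κ : ℝ, 0 < κ ∧ (1 + κ) ^ 2 * (1 - x) ^ 2 < (1 + x) ^ 2 ∧
      (1 + κ) ^ 2 * (1 - y) ^ 2 < (1 + y) ^ 2 := by
  have key : ∀ z : ℝ, 0 < z → ∀ᶠ κ in 𝓝[>] (0 : ℝ), (1 + κ) ^ 2 * (1 - z) ^ 2 < (1 + z) ^ 2 := by
    intro z hz
    have hc : ContinuousAt (fun κ : ℝ => (1 + κ) ^ 2 * (1 - z) ^ 2) 0 := by fun_prop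
    have h0 : (1 + (0 : ℝ)) ^ 2 * (1 - z) ^ 2 < (1 + z) ^ 2 := by nlinarith
    exact (hc.eventually_lt continuousAt_const h0).filter_mono nhdsWithin_le_nhds
  obtain ⟨κ, ⟨h1, h2⟩, h3⟩ := (((key x hx).and (key y hy)).and self_mem_nhdsWithin).exists
  exact ⟨κ, h3, h1, h2⟩

/-- The weights of the linear matrix inequality. For `κ = 0` the quadratic form would be a
multiple of the dissipation of `∫ u_t² / c₁² + u_x² + v_t² / c₂² + v_x²`, whose flux is continuous
across the interface. -/
def lmiWeights (c₁ c₂ κ : ℝ) : Fin 4 → ℝ :=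
  ![((1 + κ) * c₁)⁻¹, c₁⁻¹, c₂⁻¹, ((1 + κ) * c₂)⁻¹]

lemma neg_matPsiTilde_eq (c₁ c₂ g h S₅ : ℝ) (S : Fin 4 → ℝ) :
    -matPsiTilde c₁ c₂ g h 0 S S₅ =
      !![S 0 * (1 + c₁ * g) ^ 2 - S 1 * (1 - c₁ * g) ^ 2, 0, 0, 0;
         0, S 1 * c₁ ^ 2 + S 2 * c₂ ^ 2 - S 0 * c₁ ^ 2 - S 3 * c₂ ^ 2,
          S 2 * c₂ + S 3 * c₂ - S 1 * c₁ - S 0 * c₁, 0;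
         0, S 2 * c₂ + S 3 * c₂ - S 1 * c₁ - S 0 * c₁, S 1 + S 2 - S 0 - S 3, 0;
         0, 0, 0, S 3 * (1 + c₂ * h) ^ 2 - S 2 * (1 - c₂ * h) ^ 2] := by
  ext i j
  fin_cases i <;> fin_cases j <;>
    simp [matPsiTilde, matPsi, matH, matG, matE, matQ, Matrix.mul_apply, Fin.sum_univ_four,
      Matrix.diagonal_apply] <;> ring

lemma posDef_neg_matPsiTilde {c₁ c₂ g h κ : ℝ} (hc₁ : 0 < c₁) (hc₂ : 0 < c₂) (hκ : 0 < κ)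
    (hg : (1 + κ) ^ 2 * (1 - c₁ * g) ^ 2 < (1 + c₁ * g) ^ 2)
    (hh : (1 + κ) ^ 2 * (1 - c₂ * h) ^ 2 < (1 + c₂ * h) ^ 2) (S₅ : ℝ) :
    (-matPsiTilde c₁ c₂ g h 0 (lmiWeights c₁ c₂ κ) S₅).PosDef := by
  rw [neg_matPsiTilde_eq]
  refine Matrix.PosDef.of_dotProduct_mulVec_pos ?_ fun x hx => ?_
  · ext i j
    fin_cases i <;> fin_cases j <;> simp
  have hκ1 : 0 < 1 + κ := by linarith
  have hend : ∀ z c : ℝ, 0 < c → (1 + κ) ^ 2 * (1 - z) ^ 2 < (1 + z) ^ 2 →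
      0 < ((1 + κ) * c)⁻¹ * (1 + z) ^ 2 - c⁻¹ * (1 - z) ^ 2 := by
    intro z c hc hz
    have e : ((1 + κ) * c)⁻¹ * (1 + z) ^ 2 - c⁻¹ * (1 - z) ^ 2
        = ((1 + κ) * c)⁻¹ * ((1 + z) ^ 2 - (1 + κ) * (1 - z) ^ 2) := by
      field_simp
    rw [e]
    refine mul_pos (by positivity) (sub_pos.2 (lt_of_le_of_lt ?_ hz))
    gcongr
    nlinarith
  have p0 := hend _ _ hc₁ hg
  have p3 := hend _ _ hc₂ hh
  set A := ((1 + κ) * c₁)⁻¹ * (1 + c₁ * g) ^ 2 - c₁⁻¹ * (1 - c₁ * g) ^ 2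
  set D := ((1 + κ) * c₂)⁻¹ * (1 + c₂ * h) ^ 2 - c₂⁻¹ * (1 - c₂ * h) ^ 2
  have hform : star x ⬝ᵥ (!![A, 0, 0, 0;
         0, c₁⁻¹ * c₁ ^ 2 + c₂⁻¹ * c₂ ^ 2 - ((1 + κ) * c₁)⁻¹ * c₁ ^ 2 - ((1 + κ) * c₂)⁻¹ * c₂ ^ 2,
          c₂⁻¹ * c₂ + ((1 + κ) * c₂)⁻¹ * c₂ - c₁⁻¹ * c₁ - ((1 + κ) * c₁)⁻¹ * c₁, 0;
         0, c₂⁻¹ * c₂ + ((1 + κ) * c₂)⁻¹ * c₂ - c₁⁻¹ * c₁ - ((1 + κ) * c₁)⁻¹ * c₁,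
          c₁⁻¹ + c₂⁻¹ - ((1 + κ) * c₁)⁻¹ - ((1 + κ) * c₂)⁻¹, 0;
         0, 0, 0, D] : Matrix (Fin 4) (Fin 4) ℝ).mulVec x
      = A * x 0 ^ 2 + D * x 3 ^ 2 + κ / (1 + κ) * ((c₁ + c₂) * x 1 ^ 2
        + (c₁⁻¹ + c₂⁻¹) * x 2 ^ 2) := by
    simp [dotProduct, Matrix.mulVec, Fin.sum_univ_four]
    field_simp
    ring
  have hgoal : 0 < A * x 0 ^ 2 + D * x 3 ^ 2 + κ / (1 + κ) * ((c₁ + c₂) * x 1 ^ 2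
        + (c₁⁻¹ + c₂⁻¹) * x 2 ^ 2) := by
    obtain ⟨i, hi⟩ := Function.ne_iff.1 hx
    have q0 : 0 ≤ A * x 0 ^ 2 := by positivity
    have q3 : 0 ≤ D * x 3 ^ 2 := by positivity
    have q1 : 0 ≤ κ / (1 + κ) * ((c₁ + c₂) * x 1 ^ 2) := by positivity
    have q2 : 0 ≤ κ / (1 + κ) * ((c₁⁻¹ + c₂⁻¹) * x 2 ^ 2) := by positivity
    have hi2 : 0 < x i ^ 2 := sq_pos_of_ne_zero hi
    rw [mul_add]
    fin_cases i
    · have : 0 < A * x 0 ^ 2 := mul_pos p0 hi2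
      linarith
    · have : 0 < κ / (1 + κ) * ((c₁ + c₂) * x 1 ^ 2) :=
        mul_pos (by positivity) (mul_pos (by positivity) hi2)
      linarith
    · have : 0 < κ / (1 + κ) * ((c₁⁻¹ + c₂⁻¹) * x 2 ^ 2) :=
        mul_pos (by positivity) (mul_pos (by positivity) hi2)
      linarith
    · have : 0 < D * x 3 ^ 2 := mul_pos p3 hi2
      linarith
  exact hform ▸ hgoal

end CoupledWave

end

theorem mainTheorem4 (c₁ c₂ g h q : ℝ) (hc₁ : 0 < c₁) (hc₂ : 0 < c₂)
    (hg : 0 < g) (hh : 0 < h) (hq : q = 0) :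
    -- the linear matrix inequality is feasible (the block does not involve `S₅`)
    (∃ S : Fin 4 → ℝ, (∀ i, 0 < S i) ∧
      ∀ S₅ : ℝ, (-CoupledWave.matPsiTilde c₁ c₂ g h q S S₅).PosDef) ∧
    -- existence, uniqueness and exponential stability
    ∃ γ α : ℝ, 1 < γ ∧ 0 < α ∧
      ∀ X₀ : CoupledWave.State, CoupledWave.MemH X₀ →
        (∃ X : ℝ → CoupledWave.State, CoupledWave.IsSolution c₁ c₂ g h q X₀ X) ∧
        (∀ X X' : ℝ → CoupledWave.State,
          CoupledWave.IsSolution c₁ c₂ g h q X₀ X → CoupledWave.IsSolution c₁ c₂ g h q X₀ X' →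
          ∀ t, 0 ≤ t → CoupledWave.SameState (X t) (X' t)) ∧
        (∀ X : ℝ → CoupledWave.State, CoupledWave.IsSolution c₁ c₂ g h q X₀ X →
          ∀ t, 0 ≤ t →
            CoupledWave.seminormH c₁ c₂ (X t)
              ≤ γ * CoupledWave.seminormH c₁ c₂ X₀ * Real.exp (-α * t)) := by
  subst hq
  obtain ⟨κ, hκ, hκg, hκh⟩ := CoupledWave.exists_slope (mul_pos hc₁ hg) (mul_pos hc₂ hh)
  refine ⟨⟨CoupledWave.lmiWeights c₁ c₂ κ, fun i => ?_,
    CoupledWave.posDef_neg_matPsiTilde hc₁ hc₂ hκ hκg hκh⟩,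
    CoupledWave.overshoot c₁ c₂ κ, CoupledWave.decayRate c₁ c₂ κ / 2,
    CoupledWave.one_lt_overshoot hc₁ hc₂ hκ, ?_, fun X₀ hX₀ =>
    ⟨CoupledWave.exists_isSolution hc₁ hc₂ hg hh hX₀, fun X X' hX hX' t ht =>
      hX.unique hc₁ hc₂ hκ hκg.le hκh.le hX' ht, fun X hX t ht => ?_⟩⟩
  · fin_cases i <;> simp [CoupledWave.lmiWeights] <;> positivity
  · have := lt_min hc₁ hc₂
    unfold CoupledWave.decayRate
    positivity
  · obtain ⟨Y, -, hXY⟩ := hX.exists_isMildPair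
    rw [← hX.init.seminormH_eq]
    exact hXY.seminormH_le hc₁ hc₂ hκ hκg.le hκh.le ht
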